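/- Let $N>2$ be even, $K>0$, $P\in\mathbb R$. On a ring of $N$ nodes (indices cyclic) with $P_i=(-1)^{i+1}P$, let $V(\delta)=-K\sum_{i}\cos(\delta_{i+1}-\delta_i)-\sum_i P_i\delta_i$ and consider the gradient system $\dot\delta=-\nabla V(\delta)$ on $\mathbb R^N$. For an integer $m$ let $\theta_i=\delta_i-\delta_{i-1}$ be the phase differences, with $2\pi m$ added to $\theta_1=\delta_1-\delta_N$, so that $\sum_i\theta_i=2\pi m$; for $P=0$ they satisfy $\dot\theta_i=-2K\sin\theta_i+K\sin\theta_{i-1}+K\sin\theta_{i+1}$. For a vector $\theta$ with sum $2\pi m$: its basin is the set of all $\delta$ whose trajectory has phase differences converging to $\theta$ as $t\to\infty$; its potential energy boundary surface (PEBS) is the topological boundary of its basin in $\mathbb R^N$; its unstable manifold $W^u(\theta)$ is the set of all $\delta$ whose trajectory has phase differences converging to $\theta$ as $t\to-\infty$. Let $L=-\nabla^2V(\delta)$ and, for a damping $\alpha>0$, $J=\begin{pmatrix}0&I\\L&-\alpha I\end{pmatrix}$. An equilibrium is type-1 if $J$ has exactly one eigenvalue (with multiplicity) with positive real part, and stable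 if $0$ is a simple eigenvalue of $J$ (the common phase shift) and all other eigenvalues have negative real part. All claims about type and stability hold for every $\alpha>0$. Let $s\in\{1,-1\}$ and let $m$ be an integer such that $\hat\theta=\frac{(2m-s)\pi}{N-2}$ satisfies $|\hat\theta|<\pi/2$. Let $$\theta_S^m=(\theta_1,\theta_2,\dots,\theta_1,\theta_2),\qquad \theta_{1,2}=\pm\arcsin\frac{P}{2K\cos(2\pi m/N)}+\frac{2\pi m}{N}.$$ **(1) $P=0$.** Let $T_j$ be the vector with $j$-th component $s\pi-\hat\theta$ and all other components $\hat\theta$ (so $T_j=T_j^m$ if $s=1$ and $T_j=\bar T_j^m$ if $s=-1$). Let $I$ be the set of vectors with sum $2\pi m$ all of whose components lie between $\hat\theta$ and $s\pi-\hat\theta$ (that is, in $[\hat\theta,\pi-\hat\theta]$ if $s=1$ and in $[-\pi-\hat\theta,\hat\theta]$ if $s=-1$). Then for every $K>0$: - $I$ is forward invariant under the gradient dynamics and contains $\theta_S^m$ and every $T_j$; - $\theta_S^m$ is a stable equilibrium and every $T_j$ is a type-1 equilibrium; - for every $j$ the branch of the unstable manifold of $T_j$ that enters $I$ converges to $\theta_S^m$: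 there is a trajectory, with phase differences in $I$ for all $t\in\mathbb R$, that tends to $T_j$ as $t\to-\infty$ and to $\theta_S^m$ as $t\to\infty$, and every point of $W^u(T_j)$ with phase differences in $I\setminus\{T_j\}$ belongs to the basin of $\theta_S^m$; - every $\delta$ with phase differences $T_j$ lies on the PEBS of $\theta_S^m$. **(2) Small $P/K$.** There is $\varepsilon>0$, depending only on $N,m,s$, such that for all $K>0$ and all $P$ with $|P|/K<\varepsilon$: $\theta_S^m$ is a stable equilibrium; and for every $j$ there is exactly one pair $(\hat\theta_1,\hat\theta_2)\in(-\pi/2,\pi/2)^2$ with $\sin\hat\theta_1-\sin\hat\theta_2=P/K$ such that the vector $T_j$, obtained from $(\hat\theta_1,\hat\theta_2,\dots,\hat\theta_1,\hat\theta_2)$ by replacing its $j$-th component $x$ by $s\pi-x$, has sum $2\pi m$. This $T_j$ is a type-1 equilibrium, some trajectory tends to $T_j$ as $t\to-\infty$ and to $\theta_S^m$ as $t\to\infty$, and every $\delta$ with phase differences $T_j$ lies on the PEBS of $\theta_S^m$. -/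

import Mathlib

open Real Set Filter Topology

noncomputable section

namespace RingGrid

/-- Phase configurations `(δ_1, …, δ_N)` of the `N` nodes of the ring. Nodes are indexed cyclically by
`Fin N`; the index `i` stands for node number `i + 1`, so odd-numbered nodes have even index. -/
abbrev Config (N : ℕ) := EuclideanSpace ℝ (Fin N)

/-- Power at a node in the homogeneous model: `P` at odd-numbered nodes, `-P` at even-numbered ones. -/
def power {N : ℕ} (P : ℝ) (i : Fin N) : ℝ := (-1) ^ (i : ℕ) * P

/-- Potential `V(δ) = -K ∑ cos (δ_{i+1} - δ_i) - ∑ P_i δ_i`. -/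
def potential {N : ℕ} [NeZero N] (P K : ℝ) (δ : Config N) : ℝ :=
  -K * ∑ i : Fin N, cos (δ (i + 1) - δ i) - ∑ i : Fin N, power P i * δ i

/-- Right-hand side of the gradient system `dδ/dt = -∇V(δ)`. -/
def gradField {N : ℕ} [NeZero N] (P K : ℝ) (δ : Config N) : Config N :=
  -gradient (potential P K) δ

/-- `γ : ℝ → ℝ^N` is a (complete) trajectory of the gradient system. -/
def IsTrajectory {N : ℕ} [NeZero N] (P K : ℝ) (γ : ℝ → Config N) : Prop :=
  IsIntegralCurve γ (fun _ => gradField P K)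

/-- The phase differences `θ_i = δ_i - δ_{i-1}` around the ring (indices cyclic), lifted from
`ℝ / 2π` to `ℝ` by adding `2πm` to `θ_1 = δ_1 - δ_N`. Hence they sum to `2πm`, and every vector with
sum `2πm` is the phase difference vector of some `δ`, unique up to a common shift. -/
def phaseDiff {N : ℕ} [NeZero N] (m : ℤ) (δ : Config N) : Fin N → ℝ :=
  fun i => δ i - δ (i - 1) + if i = 0 then 2 * π * m else 0

/-- The Jacobian `L` of the gradient system at `δ` (a negative weighted Laplacian). -/
def lapL {N : ℕ} [NeZero N] (K : ℝ) (δ : Config N) : Matrix (Fin N) (Fin N) ℝ :=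
  Matrix.of fun i k =>
    if k = i then -(K * (cos (δ i - δ (i - 1)) + cos (δ i - δ (i + 1))))
    else if k = i - 1 then K * cos (δ i - δ (i - 1))
    else if k = i + 1 then K * cos (δ i - δ (i + 1))
    else 0

/-- The Jacobian `J = [[0, I], [L, -α I]]` of the swing equations at `(δ, 0)`. -/
def jac {N : ℕ} [NeZero N] (K α : ℝ) (δ : Config N) : Matrix (Fin N ⊕ Fin N) (Fin N ⊕ Fin N) ℝ :=
  Matrix.fromBlocks 0 1 (lapL K δ) (-(α • (1 : Matrix (Fin N) (Fin N) ℝ)))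

/-- The complex eigenvalues of `J`, with algebraic multiplicity. -/
def eigenvaluesJ {N : ℕ} [NeZero N] (K α : ℝ) (δ : Config N) : Multiset ℂ :=
  ((jac K α δ).map Complex.ofReal).charpoly.roots

/-- `δ` is an equilibrium. -/
def IsEquilibrium {N : ℕ} [NeZero N] (P K : ℝ) (δ : Config N) : Prop :=
  gradField P K δ = 0

open Classical in
/-- `δ` is a type-`n` equilibrium: `J` has exactly `n` eigenvalues with positive real part. -/
def IsTypeEquilibrium {N : ℕ} [NeZero N] (P K α : ℝ) (n : ℕ) (δ : Config N) : Prop :=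
  IsEquilibrium P K δ ∧ (eigenvaluesJ K α δ).countP (fun μ => 0 < μ.re) = n

open Classical in
/-- `δ` is a (linearly) stable equilibrium: apart from the simple eigenvalue `0` that belongs to
common shifts of all phases, every eigenvalue of `J` has negative real part. -/
def IsStableEquilibrium {N : ℕ} [NeZero N] (P K α : ℝ) (δ : Config N) : Prop :=
  IsEquilibrium P K δ ∧ (eigenvaluesJ K α δ).count 0 = 1 ∧
    ∀ μ ∈ eigenvaluesJ K α δ, μ ≠ 0 → μ.re < 0

/-- Vector of phase differences with value `a` at odd-numbered and `b` at even-numbered places. -/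
def alternating {N : ℕ} (a b : ℝ) (i : Fin N) : ℝ := if Even (i : ℕ) then a else b

/-- The state `θ_S^m = (θ_1, θ_2, …, θ_1, θ_2)`,
`θ_{1,2} = ± arcsin (P / (2 K cos (2πm/N))) + 2πm/N`. -/
def syncState (N : ℕ) (m : ℤ) (P K : ℝ) : Fin N → ℝ :=
  alternating
    (arcsin (P / (2 * K * cos (2 * π * m / N))) + 2 * π * m / N)
    (-arcsin (P / (2 * K * cos (2 * π * m / N))) + 2 * π * m / N)

/-- The alternating vector `(a, b, …, a, b)` with its `j`-th entry `x` replaced by `s π - x`.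
The sign `s = 1` gives the saddles `T_j^m`, the sign `s = -1` the saddles `T̄_j^m`. -/
def saddle {N : ℕ} (s a b : ℝ) (j : Fin N) : Fin N → ℝ :=
  Function.update (alternating a b) j (s * π - alternating a b j)

/-- For `P = 0`, the angle `θ̂ = (2m - s)π/(N - 2)` of the saddles. -/
def hatAngle (N : ℕ) (m : ℤ) (s : ℝ) : ℝ := (2 * m - s) * π / (N - 2)

/-- For general `P`, the two angles `(θ̂_1, θ̂_2) = (a, b)` of the saddle with exceptional place `j`:
both in `(-π/2, π/2)`, in balance with the power, and with total winding `2πm`. -/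
def IsSaddleAngles {N : ℕ} (P K : ℝ) (m : ℤ) (s : ℝ) (j : Fin N) (a b : ℝ) : Prop :=
  a ∈ Ioo (-(π / 2)) (π / 2) ∧ b ∈ Ioo (-(π / 2)) (π / 2) ∧
    sin a - sin b = P / K ∧ ∑ i, saddle s a b j i = 2 * π * m

/-- The region `I`: components between `θ̂` and `s π - θ̂`, and sum `2πm`. For `s = 1` the interval is
`[θ̂, π - θ̂]`, for `s = -1` it is `[-π - θ̂, θ̂]`. -/
def region (N : ℕ) (m : ℤ) (s : ℝ) : Set (Fin N → ℝ) :=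
  {θ | (∀ i, θ i ∈ uIcc (hatAngle N m s) (s * π - hatAngle N m s)) ∧ ∑ i, θ i = 2 * π * m}

/-- Forward invariance of a set of phase difference vectors under the gradient dynamics, for all
solutions on all compact time intervals `[0, τ]`. -/
def ForwardInvariant {N : ℕ} [NeZero N] (P K : ℝ) (m : ℤ) (S : Set (Fin N → ℝ)) : Prop :=
  ∀ (τ : ℝ) (γ : ℝ → Config N), 0 ≤ τ →
    IsIntegralCurveOn γ (fun _ => gradField P K) (Icc 0 τ) →
    phaseDiff m (γ 0) ∈ S → ∀ t ∈ Icc 0 τ, phaseDiff m (γ t) ∈ S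

/-- The basin of attraction of the state with phase differences `θ`, for the gradient system. -/
def basin {N : ℕ} [NeZero N] (P K : ℝ) (m : ℤ) (θ : Fin N → ℝ) : Set (Config N) :=
  {x | ∃ γ, IsTrajectory P K γ ∧ γ 0 = x ∧ Tendsto (fun t => phaseDiff m (γ t)) atTop (𝓝 θ)}

/-- The potential energy boundary surface (PEBS): the stability boundary for the gradient system. -/
def pebs {N : ℕ} [NeZero N] (P K : ℝ) (m : ℤ) (θ : Fin N → ℝ) : Set (Config N) :=
  frontier (basin P K m θ)

/-- The unstable manifold of the state with phase differences `θ`, for the gradient system. -/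
def unstableManifold {N : ℕ} [NeZero N] (P K : ℝ) (m : ℤ) (θ : Fin N → ℝ) : Set (Config N) :=
  {x | ∃ γ, IsTrajectory P K γ ∧ γ 0 = x ∧ Tendsto (fun t => phaseDiff m (γ t)) atBot (𝓝 θ)}

/-- `γ` is a trajectory that leaves `θ` (as `t → -∞`) and converges to `θ'` (as `t → ∞`). -/
def IsConnection {N : ℕ} [NeZero N] (P K : ℝ) (m : ℤ) (θ θ' : Fin N → ℝ) (γ : ℝ → Config N) :
    Prop :=
  IsTrajectory P K γ ∧ Tendsto (fun t => phaseDiff m (γ t)) atBot (𝓝 θ) ∧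
    Tendsto (fun t => phaseDiff m (γ t)) atTop (𝓝 θ')

end RingGrid

end

set_option linter.unusedSectionVars false

/-! Write the power as P = K (sin a - sin b), put τ = (a, b, …, a, b) and Δ_i = sin θ_i - sin τ_i.
The phase differences then obey θ_i' = K (Δ_{i+1} + Δ_{i-1} - 2 Δ_i), a discrete diffusion. Only s =
1 needs work: the reflection δ ↦ -δ, which also negates m and P, exchanges the two signs.

Take a, b to be the angles of the saddle. Every θ with sum 2πm then satisfies ∑ (θ_i - τ_i) = π - 2
τ_j. This budget drives the proof. On θ ≥ τ it gives θ_j ≤ π - τ_j, with equality only at the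
saddle. An angle in [τ_i, π - τ_i] has Δ_i ≥ 0, so a component that sits at τ_i is pushed up by its
neighbours. For P = 0 the budget alone keeps every angle below π - θ̂, and the region I is invariant
(`forwardInvariant_region_one`). For P ≠ 0 it controls only the j-th angle, so the caps θ_k ≤ π/2, k
≠ j, are added. They persist because the neighbours of an angle π/2 share too little budget for both
their sines to be near 1 (`NearSaddle.forwardInvariant_cappedRegion`).

Convergence comes from the gradient structure. The powers cancel around the ring, so V is a function
of θ; along a trajectory whose phase differences stay in a compact set, ∇V tends to 0, in either
time direction, and the trajectory converges if that set admits only one equilibrium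
(`tendsto_phaseDiff_of_mem_compact_aux`). At an equilibrium Δ is constant, and the budget leaves
only the synchronous state and saddles.

The connection is obtained by compactness instead of an unstable manifold theorem. Near the saddle
θ_j cannot increase. Starting ever closer to the saddle gives trajectories that need ever longer to
reach the face θ_j = π - τ_j - η; a limit of their exit points has its whole backward trajectory
between this face and the saddle (`NearSaddle.exists_connection`). The saddle is a limit of shifted
points of the connection but is itself at rest, hence lies on the boundary of the basin.

For the type, a Schur complement shows that the eigenvalues of J are the roots of μ² + αμ = λ with λ
an eigenvalue of L (`charpoly_jac`). At the saddle the form of L is nonpositive on a hyperplane and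
positive at one vector, so L has exactly one positive eigenvalue. -/

namespace RingGrid

/-! ### Flows of Lipschitz fields, invariance of one-sided constraints, and Barbalat's lemma. -/

section ODE

open scoped NNReal

variable {E : Type*} [NormedAddCommGroup E] [NormedSpace ℝ E]

/-- Two integral curves of a Lipschitz field separate at most exponentially in forward time. -/
theorem dist_integralCurve_le {v : E → E} {L : ℝ≥0} (hL : LipschitzWith L v) {γ γ' : ℝ → E}
    (h : IsIntegralCurve γ fun _ => v) (h' : IsIntegralCurve γ' fun _ => v) {t : ℝ} (ht : 0 ≤ t) :
    dist (γ t) (γ' t) ≤ dist (γ 0) (γ' 0) * exp (L * t) := by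
  have := dist_le_of_trajectories_ODE (v := fun _ => v) (f := γ) (g := γ') (a := 0) (b := t)
    (δ := dist (γ 0) (γ' 0)) (fun _ => hL) h.continuous.continuousOn
    (fun s _ => (h s).hasDerivWithinAt) h'.continuous.continuousOn
    (fun s _ => (h' s).hasDerivWithinAt) le_rfl t ⟨ht, le_rfl⟩
  simpa using this

theorem isIntegralCurve_neg_time {v : E → E} {γ : ℝ → E} (h : IsIntegralCurve γ fun _ => v) :
    IsIntegralCurve (fun t => γ (-t)) fun _ x => -v x := by
  intro t
  have := (h (-t)).scomp t (hasDerivAt_neg t)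
  simpa [Function.comp_def] using this

theorem dist_integralCurve_neg_le {v : E → E} {L : ℝ≥0} (hL : LipschitzWith L v) {γ γ' : ℝ → E}
    (h : IsIntegralCurve γ fun _ => v) (h' : IsIntegralCurve γ' fun _ => v) {t : ℝ} (ht : 0 ≤ t) :
    dist (γ (-t)) (γ' (-t)) ≤ dist (γ 0) (γ' 0) * exp (L * t) := by
  have := dist_integralCurve_le (v := fun x => -v x) hL.neg (isIntegralCurve_neg_time h)
    (isIntegralCurve_neg_time h') ht
  simpa using this

theorem integralCurve_unique {v : E → E} {L : ℝ≥0} (hL : LipschitzWith L v) {γ γ' : ℝ → E}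
    (h : IsIntegralCurve γ fun _ => v) (h' : IsIntegralCurve γ' fun _ => v) (h0 : γ 0 = γ' 0) :
    γ = γ' :=
  ODE_solution_unique_univ (v := fun _ => v) (s := fun _ => univ) (t₀ := 0)
    (fun _ => hL.lipschitzOnWith) (fun t => ⟨h t, mem_univ _⟩) (fun t => ⟨h' t, mem_univ _⟩) h0

/-- A bounded Lipschitz vector field is complete. -/
theorem exists_integralCurve [CompleteSpace E] {v : E → E} {L : ℝ≥0} (hL : LipschitzWith L v)
    {M : ℝ≥0} (hM : ∀ x, ‖v x‖ ≤ M) (x : E) : ∃ γ : ℝ → E, γ 0 = x ∧ IsIntegralCurve γ fun _ => v := by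
  have loc : ∀ n : ℕ, ∃ γ : ℝ → E, γ 0 = x ∧
      ∀ t ∈ Icc (-((n : ℝ) + 1)) (n + 1), HasDerivWithinAt γ (v (γ t)) (Icc (-((n : ℝ) + 1)) (n + 1)) t := by
    intro n
    have hmem : (0 : ℝ) ∈ Icc (-((n : ℝ) + 1)) (n + 1) := by constructor <;> linarith [n.cast_nonneg (α := ℝ)]
    -- The bound M holds everywhere, so a ball of radius M (n + 1) is large enough for the whole
    -- interval.
    have hp : IsPicardLindelof (fun _ : ℝ => v) (⟨0, hmem⟩ : Icc (-((n : ℝ) + 1)) (n + 1)) x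
        (M * (n + 1)) 0 M L :=
      { lipschitzOnWith := fun _ _ => hL.lipschitzOnWith
        continuousOn := fun _ _ => continuousOn_const
        norm_le := fun _ _ y _ => hM y
        mul_max_le := by simp }
    exact hp.exists_eq_forall_mem_Icc_hasDerivWithinAt₀
  choose g hg0 hg using loc
  have hgd : ∀ n : ℕ, ∀ t ∈ Ioo (-((n : ℝ) + 1)) (n + 1), HasDerivAt (g n) (v (g n t)) t := fun n t ht =>
    (hg n t (Ioo_subset_Icc_self ht)).hasDerivAt (Icc_mem_nhds ht.1 ht.2)
  have heq : ∀ n k : ℕ, n ≤ k → ∀ t ∈ Ioo (-((n : ℝ) + 1)) (n + 1), g n t = g k t := by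
    intro n k hnk
    have hnk' : (n : ℝ) ≤ k := by exact_mod_cast hnk
    have h0 : (0 : ℝ) ∈ Ioo (-((n : ℝ) + 1)) (n + 1) := by
      constructor <;> linarith [n.cast_nonneg (α := ℝ)]
    exact ODE_solution_unique_of_mem_Ioo (v := fun _ => v) (s := fun _ => univ) (K := L)
      (fun _ _ => hL.lipschitzOnWith) h0 (fun t ht => ⟨hgd n t ht, mem_univ _⟩)
      (fun t ht => ⟨hgd k t ⟨by linarith [ht.1], by linarith [ht.2]⟩, mem_univ _⟩)
      ((hg0 n).trans (hg0 k).symm)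
  -- The n-th solution lives on radius n + 1, so that t is interior to the interval of index ⌈|t|⌉;
  -- by uniqueness the pieces agree near t.
  refine ⟨fun t => g ⌈|t|⌉₊ t, by simpa using hg0 0, fun t => ?_⟩
  have hlt : ∀ s : ℝ, s ∈ Ioo (-((⌈|s|⌉₊ : ℝ) + 1)) (⌈|s|⌉₊ + 1) := fun s => by
    have := abs_le.1 (Nat.le_ceil |s|)
    constructor <;> linarith
  set n := ⌈|t|⌉₊
  have key : ∀ s ∈ Ioo (-((n : ℝ) + 1)) (n + 1), g ⌈|s|⌉₊ s = g n s := by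
    intro s hs
    rcases le_total n ⌈|s|⌉₊ with hc | hc
    · exact (heq _ _ hc s hs).symm
    · exact heq _ _ hc s (hlt s)
  have := hgd n t (hlt t)
  exact this.congr_of_eventuallyEq
    (Filter.eventually_of_mem (Ioo_mem_nhds (hlt t).1 (hlt t).2) key)

/-- Squaring removes the kink of the positive part, which makes the total violation of a system of
constraints differentiable. -/
theorem hasDerivAt_max_zero_sq (x : ℝ) :
    HasDerivAt (fun y : ℝ => max y 0 ^ 2) (2 * max x 0) x := by
  rcases lt_trichotomy x 0 with h | rfl | h
  · rw [max_eq_right h.le]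
    refine ((hasDerivAt_const x (0 : ℝ)).congr_of_eventuallyEq ?_).congr_deriv (by simp)
    filter_upwards [Iio_mem_nhds h] with y hy
    rw [max_eq_right (le_of_lt hy)]; simp
  · rw [hasDerivAt_iff_isLittleO_nhds_zero]
    simp only [zero_add, max_self, mul_zero, smul_zero, sub_zero, ne_eq, OfNat.ofNat_ne_zero,
      not_false_eq_true, zero_pow]
    have h1 : (fun y : ℝ => max y 0 ^ 2) =O[𝓝 0] fun y => y ^ 2 := by
      refine Asymptotics.IsBigO.of_bound 1 (Eventually.of_forall fun y => ?_)
      rw [one_mul, norm_of_nonneg (by positivity), norm_of_nonneg (by positivity)]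
      rcases le_total y 0 with hy | hy
      · rw [max_eq_right hy]; nlinarith
      · rw [max_eq_left hy]
    refine h1.trans_isLittleO ?_
    simpa using Asymptotics.isLittleO_pow_id (𝕜 := ℝ) (n := 2) (by norm_num)
  · rw [max_eq_left h.le]
    refine ((hasDerivAt_pow 2 x).congr_of_eventuallyEq ?_).congr_deriv (by simp)
    filter_upwards [Ioi_mem_nhds h] with y hy
    rw [max_eq_left (le_of_lt hy)]

/-- If finitely many functions start nonpositive and each positive one grows at most
proportionally to the total positive part, then all stay nonpositive. -/
theorem quasi_invariance {ι : Type*} [Fintype ι] {v v' : ι → ℝ → ℝ} {τ C : ℝ} (hC : 0 ≤ C)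
    (hcont : ∀ i, ContinuousOn (v i) (Icc 0 τ))
    (hder : ∀ i, ∀ t ∈ Ioo 0 τ, HasDerivAt (v i) (v' i t) t) (h0 : ∀ i, v i 0 ≤ 0)
    (hb : ∀ i, ∀ t ∈ Ioo 0 τ, 0 < v i t → v' i t ≤ C * ∑ j, max (v j t) 0) :
    ∀ i, ∀ t ∈ Icc 0 τ, v i t ≤ 0 := by
  classical
  intro i t ht
  -- Grönwall: the hypothesis and Cauchy–Schwarz give W' ≤ D W, and W starts at 0.
  set W : ℝ → ℝ := fun t => ∑ i, max (v i t) 0 ^ 2 with hW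
  set D : ℝ := 2 * C * Fintype.card ι with hD
  have hWd : ∀ t ∈ Ioo 0 τ, HasDerivAt W (∑ i, 2 * max (v i t) 0 * v' i t) t := by
    intro t ht
    exact HasDerivAt.fun_sum fun i _ => (hasDerivAt_max_zero_sq (v i t)).comp t (hder i t ht)
  have hbound : ∀ t ∈ Ioo 0 τ, ∑ i, 2 * max (v i t) 0 * v' i t ≤ D * W t := by
    intro t ht
    have h1 : ∑ i, 2 * max (v i t) 0 * v' i t
        ≤ ∑ i, 2 * max (v i t) 0 * (C * ∑ j, max (v j t) 0) := by
      refine Finset.sum_le_sum fun i _ => ?_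
      rcases le_or_gt (v i t) 0 with h | h
      · simp [max_eq_right h]
      · exact mul_le_mul_of_nonneg_left (hb i t ht h) (by positivity)
    have h2 : ∑ i, 2 * max (v i t) 0 * (C * ∑ j, max (v j t) 0)
        = 2 * C * (∑ j, max (v j t) 0) ^ 2 := by
      rw [← Finset.sum_mul, ← Finset.mul_sum]; ring
    have h3 : (∑ j, max (v j t) 0) ^ 2 ≤ Fintype.card ι * W t := by
      have := sq_sum_le_card_mul_sum_sq (s := (Finset.univ : Finset ι)) (f := fun j => max (v j t) 0)
      simpa using this
    calc _ ≤ _ := h1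
      _ = _ := h2
      _ ≤ 2 * C * (Fintype.card ι * W t) := mul_le_mul_of_nonneg_left h3 (by positivity)
      _ = D * W t := by rw [hD]; ring
  have hWc : ContinuousOn W (Icc 0 τ) :=
    continuousOn_finsetSum _ fun i _ => ((hcont i).sup continuousOn_const).pow 2
  have hanti : AntitoneOn (fun t => W t * exp (-(D * t))) (Icc 0 τ) := by
    refine antitoneOn_of_hasDerivWithinAt_nonpos (convex_Icc 0 τ)
      (f' := fun t => (∑ i, 2 * max (v i t) 0 * v' i t) * exp (-(D * t))
        + W t * (exp (-(D * t)) * -D)) (hWc.mul (by fun_prop)) ?_ ?_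
    · intro t ht
      rw [interior_Icc] at ht
      have he : HasDerivAt (fun t : ℝ => exp (-(D * t))) (exp (-(D * t)) * -D) t := by
        simpa using ((hasDerivAt_id t).const_mul D).neg.exp
      exact ((hWd t ht).mul he).hasDerivWithinAt
    · intro t ht
      rw [interior_Icc] at ht
      have := mul_nonneg (sub_nonneg.2 (hbound t ht)) (exp_pos (-(D * t))).le
      linarith
  have hW0 : W 0 = 0 := by
    simp only [hW]
    exact Finset.sum_eq_zero fun i _ => by rw [max_eq_right (h0 i)]; simp
  have hle := hanti ⟨le_rfl, ht.1.trans ht.2⟩ ht ht.1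
  simp only [hW0, zero_mul] at hle
  have hWt : W t ≤ 0 := by
    by_contra h
    push Not at h
    exact absurd hle (not_le.2 (mul_pos h (exp_pos _)))
  have hi : max (v i t) 0 ^ 2 ≤ W t :=
    Finset.single_le_sum (f := fun i => max (v i t) 0 ^ 2) (fun _ _ => sq_nonneg _) (Finset.mem_univ i)
  have hz : max (v i t) 0 = 0 := by
    have : max (v i t) 0 ^ 2 = 0 := le_antisymm (hi.trans hWt) (sq_nonneg _)
    simpa using this
  exact max_eq_right_iff.1 hz

/-- Barbalat's lemma for monotone functions. -/
theorem tendsto_deriv_zero_of_bounded {u g : ℝ → ℝ} {B C : ℝ} (hu : ∀ t, HasDerivAt u (g t) t)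
    (hg : ∀ t, 0 ≤ g t) (hB : ∀ s t, |g s - g t| ≤ B * |s - t|) (hC : ∀ t, 0 ≤ t → u t ≤ C) :
    Tendsto g atTop (𝓝 0) := by
  have hmono : Monotone u := monotone_of_deriv_nonneg (fun t => (hu t).differentiableAt)
    fun t => by rw [(hu t).deriv]; exact hg t
  have hB0 : 0 ≤ B := by simpa using (abs_nonneg _).trans (hB 1 0)
  obtain ⟨l, hl⟩ : ∃ l, Tendsto u atTop (𝓝 l) := by
    rcases tendsto_atTop_of_monotone hmono with h | h
    · obtain ⟨t, ht1, ht2⟩ := ((h.eventually_gt_atTop C).and (eventually_ge_atTop 0)).exists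
      exact absurd (hC t ht2) (not_le.2 ht1)
    · exact h
  rw [Metric.tendsto_atTop]
  intro ε hε
  set r : ℝ := ε / (2 * (B + 1)) with hr
  have hr0 : 0 < r := by positivity
  have hBr : B * r ≤ ε / 2 := by
    rw [hr, mul_div_assoc', div_le_div_iff₀ (by positivity) (by positivity)]; nlinarith
  have hdiff : Tendsto (fun t => u (t + r) - u t) atTop (𝓝 0) := by
    simpa using (hl.comp (tendsto_atTop_add_const_right _ r tendsto_id)).sub hl
  obtain ⟨T, hT⟩ := Metric.tendsto_atTop.1 hdiff (ε / 4 * r) (by positivity)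
  refine ⟨T, fun t ht => ?_⟩
  obtain ⟨ξ, hξ, hξe⟩ := exists_hasDerivAt_eq_slope u g (show t < t + r by linarith)
    (fun x _ => (hu x).continuousAt.continuousWithinAt) (fun x _ => hu x)
  have h1 := hT t ht
  rw [Real.dist_eq, sub_zero] at h1
  have h2 : g ξ < ε / 4 := by
    rw [hξe, add_sub_cancel_left, div_lt_iff₀ hr0]
    exact (le_abs_self _).trans_lt h1
  have h3 : g t - g ξ ≤ B * r := by
    refine (le_abs_self _).trans ((hB t ξ).trans (mul_le_mul_of_nonneg_left ?_ hB0))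
    rw [abs_le]; constructor <;> linarith [hξ.1, hξ.2]
  rw [Real.dist_eq, sub_zero, abs_of_nonneg (hg t)]
  linarith

end ODE

/-! ### The ring, phase differences as coordinates, and convergence of confined trajectories. -/

section Ring

variable {N : ℕ}

theorem alternating_add_swap (a b : ℝ) (i : Fin N) :
    alternating a b i + alternating b a i = a + b := by
  unfold alternating
  split_ifs <;> ring

theorem alternating_self (a : ℝ) (i : Fin N) : alternating a a i = a := by
  simp [alternating]

theorem comp_alternating (f : ℝ → ℝ) (a b : ℝ) (i : Fin N) :
    f (alternating a b i) = alternating (f a) (f b) i := by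
  unfold alternating
  split_ifs <;> rfl

theorem power_eq_alternating (P : ℝ) (i : Fin N) : power P i = alternating P (-P) i := by
  unfold power alternating
  split_ifs with h
  · simp [h.neg_one_pow]
  · simp [(Nat.not_even_iff_odd.1 h).neg_one_pow]

theorem saddle_same (s a b : ℝ) (j : Fin N) :
    saddle s a b j j = s * π - alternating a b j := by simp [saddle]

theorem saddle_of_ne (s a b : ℝ) {i j : Fin N} (h : i ≠ j) :
    saddle s a b j i = alternating a b i := by simp [saddle, h]

variable [NeZero N]

theorem sum_add_one (f : Fin N → ℝ) : ∑ i, f (i + 1) = ∑ i, f i :=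
  Equiv.sum_comp (Equiv.addRight (1 : Fin N)) f

theorem sum_sub_one (f : Fin N → ℝ) : ∑ i, f (i - 1) = ∑ i, f i :=
  Equiv.sum_comp (Equiv.subRight (1 : Fin N)) f

theorem even_val_add_one (hN : Even N) (i : Fin N) :
    Even ((i + 1 : Fin N) : ℕ) ↔ ¬Even (i : ℕ) := by
  rw [Fin.val_add, Even.mod_even_iff hN, Nat.even_add, Fin.val_one', Even.mod_even_iff hN]
  simp

theorem even_val_sub_one (hN : Even N) (i : Fin N) :
    Even ((i - 1 : Fin N) : ℕ) ↔ ¬Even (i : ℕ) := by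
  have := even_val_add_one hN (i - 1)
  rw [sub_add_cancel] at this
  tauto

theorem add_one_ne_self (hN : 1 < N) (i : Fin N) : i + 1 ≠ i := by
  rw [Ne, add_eq_left]
  intro h
  have := congrArg Fin.val h
  rw [Fin.val_one', Fin.val_zero, Nat.mod_eq_of_lt hN] at this
  omega

theorem sub_one_ne_self (hN : 1 < N) (i : Fin N) : i - 1 ≠ i := fun h =>
  add_one_ne_self hN i (by rw [← eq_sub_iff_add_eq, h])

theorem add_one_add_one_ne_self (hN : 2 < N) (i : Fin N) : i + 1 + 1 ≠ i := by
  rw [add_assoc, Ne, add_eq_left]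
  intro h
  have := congrArg Fin.val h
  rw [Fin.val_add, Fin.val_one', Fin.val_zero, Nat.mod_eq_of_lt (by omega : 1 < N),
    Nat.mod_eq_of_lt hN] at this
  omega

theorem sub_one_ne_add_one (hN : 2 < N) (i : Fin N) : i - 1 ≠ i + 1 := fun h =>
  add_one_add_one_ne_self hN i (by rw [← h, sub_add_cancel])

theorem eq_const_of_add_one {f : Fin N → ℝ} (h : ∀ i, f (i + 1) = f i) (i j : Fin N) :
    f i = f j := by
  have key : ∀ k : ℕ, f (Fin.ofNat N k) = f (Fin.ofNat N 0) := by
    intro k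
    induction k with
    | zero => rfl
    | succ k ih =>
      rw [← ih, ← h (Fin.ofNat N k)]
      congr 1
      ext
      simp [Fin.val_add]
  have hi := key i
  have hj := key j
  rw [Fin.ofNat_val_eq_self] at hi hj
  rw [hi, hj]

theorem alternating_add_one (hN : Even N) (a b : ℝ) (i : Fin N) :
    alternating a b (i + 1) = alternating b a i := by
  unfold alternating
  by_cases h : Even (i : ℕ) <;> simp [even_val_add_one hN, h]

theorem alternating_sub_one (hN : Even N) (a b : ℝ) (i : Fin N) :
    alternating a b (i - 1) = alternating b a i := by
  unfold alternating
  by_cases h : Even (i : ℕ) <;> simp [even_val_sub_one hN, h]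

theorem sum_alternating (hN : Even N) (a b : ℝ) :
    ∑ i : Fin N, alternating a b i = N * ((a + b) / 2) := by
  have h1 : ∑ i : Fin N, (alternating a b i + alternating b a i) = N * (a + b) := by
    simp [alternating_add_swap, mul_add]
  have h2 : ∑ i : Fin N, alternating b a i = ∑ i : Fin N, alternating a b i := by
    rw [← sum_add_one]
    simp [alternating_add_one hN]
  rw [Finset.sum_add_distrib, h2] at h1
  linarith

theorem sum_saddle (hN : Even N) (s a b : ℝ) (j : Fin N) :
    ∑ i, saddle s a b j i = N * ((a + b) / 2) + s * π - 2 * alternating a b j := by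
  unfold saddle
  rw [Finset.sum_update_of_mem (Finset.mem_univ j)]
  have := Finset.add_sum_erase Finset.univ (fun i => alternating a b i) (Finset.mem_univ j)
  rw [sum_alternating hN] at this
  rw [Finset.sdiff_singleton_eq_erase]
  linarith

theorem sum_phaseDiff (m : ℤ) (δ : Config N) : ∑ i, phaseDiff m δ i = 2 * π * m := by
  unfold phaseDiff
  rw [Finset.sum_add_distrib, Finset.sum_sub_distrib, sum_sub_one fun i => δ i]
  simp

theorem continuous_phaseDiff (m : ℤ) : Continuous (phaseDiff (N := N) m) := by
  unfold phaseDiff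
  fun_prop

theorem sin_phaseDiff (m : ℤ) (δ : Config N) (i : Fin N) :
    sin (phaseDiff m δ i) = sin (δ i - δ (i - 1)) := by
  unfold phaseDiff
  split_ifs
  · rw [show 2 * π * (m : ℝ) = m * (2 * π) by ring, Real.sin_add_int_mul_two_pi]
  · simp

theorem cos_phaseDiff (m : ℤ) (δ : Config N) (i : Fin N) :
    cos (phaseDiff m δ i) = cos (δ i - δ (i - 1)) := by
  unfold phaseDiff
  split_ifs
  · rw [show 2 * π * (m : ℝ) = m * (2 * π) by ring, Real.cos_add_int_mul_two_pi]
  · simp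

/-- Every vector with sum `2πm` is a vector of phase differences. -/
theorem exists_phaseDiff_eq (m : ℤ) (θ : Fin N → ℝ) (h : ∑ i, θ i = 2 * π * m) :
    ∃ δ : Config N, phaseDiff m δ = θ := by
  set S : ℕ → ℝ := fun n => ∑ k ∈ Finset.range n, θ (Fin.ofNat N (k + 1)) with hS
  refine ⟨WithLp.toLp 2 fun i => S i, ?_⟩
  have hpos : ∀ i : Fin N, i ≠ 0 → phaseDiff m (WithLp.toLp 2 fun i => S i : Config N) i = θ i := by
    intro i hi
    have hi' : (i : ℕ) ≠ 0 := fun h => hi (Fin.ext (by simpa using h))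
    have hv : ((i - 1 : Fin N) : ℕ) = i - 1 := Fin.val_sub_one_of_ne_zero hi
    simp only [phaseDiff, hi, if_false, add_zero, hv]
    obtain ⟨k, hk⟩ := Nat.exists_eq_succ_of_ne_zero hi'
    simp only [hS, hk, Nat.succ_sub_one, Finset.sum_range_succ, add_sub_cancel_left]
    congr 1
    ext
    simp [← Nat.succ_eq_add_one, ← hk]
  funext i
  -- The partial sums realise all entries except the one at 0, where the ring closes; that one is
  -- forced because both sums equal 2πm.
  by_cases hi : i = 0
  · subst hi
    have h1 := sum_phaseDiff m (WithLp.toLp 2 fun i => S i : Config N)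
    rw [← Finset.add_sum_erase _ _ (Finset.mem_univ (0 : Fin N))] at h1 h
    rw [Finset.sum_congr rfl fun i hi => hpos i (Finset.ne_of_mem_erase hi)] at h1
    linarith
  · exact hpos i hi

/-- Common phase shift. -/
theorem phaseDiff_add_const (m : ℤ) (δ : Config N) (c : ℝ) :
    phaseDiff m (δ + WithLp.toLp 2 fun _ => c) = phaseDiff m δ := by
  funext i
  simp [phaseDiff]

/-- The right-hand side of the gradient system as a function of the phase differences. -/
noncomputable def force (P K : ℝ) (θ : Fin N → ℝ) (i : Fin N) : ℝ :=
  power P i - K * sin (θ i) + K * sin (θ (i + 1))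

theorem continuous_force (P K : ℝ) : Continuous (force (N := N) P K) := by
  unfold force
  fun_prop

theorem hasGradientAt_potential (P K : ℝ) (m : ℤ) (δ : Config N) :
    HasGradientAt (potential P K) (-(WithLp.toLp 2 (force P K (phaseDiff m δ)) : Config N)) δ := by
  rw [hasGradientAt_iff_hasFDerivAt]
  have hp : ∀ i : Fin N, HasFDerivAt (fun x : Config N => x i)
      (EuclideanSpace.proj i : Config N →L[ℝ] ℝ) δ := fun i =>
    (EuclideanSpace.proj i : Config N →L[ℝ] ℝ).hasFDerivAt
  have h1 := ((HasFDerivAt.fun_sum (u := Finset.univ) fun i _ =>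
    ((hp (i + 1)).fun_sub (hp i)).cos).const_mul (-K)).fun_sub
    (HasFDerivAt.fun_sum (u := Finset.univ) fun i _ => (hp i).const_mul (power P i))
  refine h1.congr_fderiv ?_
  ext w
  simp only [force, sin_phaseDiff, add_sub_cancel_right, sub_apply,
    smul_apply, sum_apply, smul_eq_mul,
    InnerProductSpace.toDual_apply_apply, PiLp.inner_apply, PiLp.neg_apply]
  simp only [PiLp.proj_apply, RCLike.inner_apply, conj_trivial]
  have h2 := sum_sub_one fun i => sin (δ (i + 1) - δ i) * w (i + 1)
  simp only [sub_add_cancel] at h2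
  have h3 : ∑ i, -sin (δ (i + 1) - δ i) * (w (i + 1) - w i)
      = -∑ i, sin (δ i - δ (i - 1)) * w i + ∑ i, sin (δ (i + 1) - δ i) * w i := by
    rw [h2, ← Finset.sum_neg_distrib, ← Finset.sum_add_distrib]
    exact Finset.sum_congr rfl fun i _ => by ring
  rw [h3, mul_add, mul_neg, neg_mul, neg_neg, neg_mul, Finset.mul_sum, Finset.mul_sum,
    ← sub_eq_add_neg, ← Finset.sum_sub_distrib, ← Finset.sum_sub_distrib]
  exact Finset.sum_congr rfl fun i _ => by ring

theorem gradField_eq (P K : ℝ) (m : ℤ) (δ : Config N) :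
    gradField P K δ = WithLp.toLp 2 (force P K (phaseDiff m δ)) := by
  rw [gradField, (hasGradientAt_potential P K m δ).gradient, neg_neg]

theorem gradField_apply (P K : ℝ) (m : ℤ) (δ : Config N) (i : Fin N) :
    gradField P K δ i = force P K (phaseDiff m δ) i := by
  rw [gradField_eq P K m]

theorem isEquilibrium_iff {P K : ℝ} {m : ℤ} {δ : Config N} :
    IsEquilibrium P K δ ↔ force P K (phaseDiff m δ) = 0 := by
  rw [IsEquilibrium, gradField_eq P K m, WithLp.toLp_eq_zero]

/-- The field is a linear map, then a componentwise sine, then a linear map, plus a constant. This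
makes the flow complete and gives exponential bounds on separation. -/
theorem exists_lipschitz_bound_gradField (P K : ℝ) :
    ∃ L M : NNReal, LipschitzWith L (gradField (N := N) P K) ∧ ∀ x, ‖gradField (N := N) P K x‖ ≤ M := by
  let B : Config N →L[ℝ] (Fin N → ℝ) := LinearMap.toContinuousLinearMap
    { toFun := fun δ i => δ i - δ (i - 1)
      map_add' := fun x y => by funext i; simp; ring
      map_smul' := fun c x => by funext i; simp; ring }
  let A : (Fin N → ℝ) →L[ℝ] Config N := LinearMap.toContinuousLinearMap
    { toFun := fun y => WithLp.toLp 2 fun i => K * y (i + 1) - K * y i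
      map_add' := fun x y => by ext i; simp; ring
      map_smul' := fun c x => by ext i; simp; ring }
  let S : (Fin N → ℝ) → (Fin N → ℝ) := fun y i => sin (y i)
  let p : Config N := WithLp.toLp 2 (power P)
  have hS : LipschitzWith 1 S := by
    refine LipschitzWith.of_dist_le_mul fun x y => ?_
    rw [NNReal.coe_one, one_mul, dist_pi_le_iff dist_nonneg]
    intro i
    refine le_trans ?_ (dist_le_pi_dist x y i)
    rw [Real.dist_eq, Real.dist_eq]
    exact abs_sin_sub_sin_le _ _
  have heq : gradField (N := N) P K = fun δ => A (S (B δ)) + p := by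
    funext δ
    ext i
    rw [gradField_apply P K 0]
    simp only [force, sin_phaseDiff, add_sub_cancel_right]
    change _ = (K * sin (δ (i + 1) - δ (i + 1 - 1)) - K * sin (δ i - δ (i - 1))) + power P i
    rw [add_sub_cancel_right]
    ring
  refine ⟨‖A‖₊ * (1 * ‖B‖₊), ‖A‖₊ + ‖p‖₊, ?_, fun x => ?_⟩
  · rw [heq]
    have := (A.lipschitz.comp (hS.comp B.lipschitz)).add (LipschitzWith.const p)
    simpa [Function.comp_def] using this
  · rw [heq]
    refine (norm_add_le _ _).trans ?_
    have h1 : ‖S (B x)‖ ≤ 1 := by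
      rw [pi_norm_le_iff_of_nonneg zero_le_one]
      exact fun i => abs_sin_le_one _
    have h2 : ‖A (S (B x))‖ ≤ ‖A‖ :=
      (A.le_opNorm _).trans (mul_le_of_le_one_right (norm_nonneg _) h1)
    simpa using h2

theorem exists_trajectory (P K : ℝ) (x : Config N) : ∃ γ, IsTrajectory P K γ ∧ γ 0 = x := by
  obtain ⟨L, M, hL, hM⟩ := exists_lipschitz_bound_gradField (N := N) P K
  obtain ⟨γ, h0, h⟩ := exists_integralCurve hL hM x
  exact ⟨γ, h, h0⟩

theorem trajectory_unique {P K : ℝ} {γ γ' : ℝ → Config N} (h : IsTrajectory P K γ)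
    (h' : IsTrajectory P K γ') (h0 : γ 0 = γ' 0) : γ = γ' := by
  obtain ⟨L, M, hL, hM⟩ := exists_lipschitz_bound_gradField (N := N) P K
  exact integralCurve_unique hL h h' h0

/-- The potential in terms of the phase differences. -/
theorem potential_eq (hN : Even N) (P K : ℝ) (m : ℤ) (δ : Config N) :
    potential P K δ = -K * ∑ i, cos (phaseDiff m δ i)
      - ∑ i, alternating 0 (-P) i * phaseDiff m δ i := by
  unfold potential
  congr 1
  · congr 1
    rw [← sum_add_one fun i => cos (phaseDiff m δ i)]
    simp [cos_phaseDiff]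
  -- The weight at index 0 is chosen to be 0, which removes the winding term 2πm.
  · have h1 : ∀ i, alternating 0 (-P) i * phaseDiff m δ i
        = alternating 0 (-P) i * δ i - alternating (-P) 0 (i - 1) * δ (i - 1) := by
      intro i
      rw [alternating_sub_one hN]
      unfold phaseDiff
      split_ifs with h
      · subst h; simp [alternating]
      · ring
    rw [Finset.sum_congr rfl fun i _ => h1 i, Finset.sum_sub_distrib,
      sum_sub_one fun i => alternating (-P) 0 i * δ i, ← Finset.sum_sub_distrib]
    refine Finset.sum_congr rfl fun i _ => ?_
    rw [power_eq_alternating]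
    unfold alternating
    split_ifs <;> ring

/-- The sign σ = ±1 treats both time directions at once: -σ V increases along c at the rate ‖∇V‖²,
and it is bounded since V depends only on the phase differences. Barbalat's lemma gives ∇V → 0; away
from θ the speed has a positive minimum on C, so c must approach θ. -/
theorem tendsto_phaseDiff_of_mem_compact_aux (hN : Even N) {P K : ℝ} {m : ℤ}
    {C : Set (Fin N → ℝ)} (hC : IsCompact C) {θ : Fin N → ℝ}
    (hθ : ∀ y ∈ C, force P K y = 0 → y = θ) {σ : ℝ} (hσ : σ * σ = 1) {c : ℝ → Config N}
    (hc : ∀ t, HasDerivAt c (σ • gradField P K (c t)) t) (hin : ∀ t, 0 ≤ t → phaseDiff m (c t) ∈ C) :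
    Tendsto (fun t => phaseDiff m (c t)) atTop (𝓝 θ) := by
  obtain ⟨L, M, hL, hM⟩ := exists_lipschitz_bound_gradField (N := N) P K
  set v := gradField (N := N) P K
  have hσn : ‖σ‖ = 1 := by
    have : |σ| * |σ| = 1 := by rw [abs_mul_abs_self, hσ]
    rw [Real.norm_eq_abs]; nlinarith [abs_nonneg σ]
  have hclip : ∀ s t, ‖c s - c t‖ ≤ M * |s - t| := by
    intro s t
    refine Convex.norm_image_sub_le_of_norm_hasDerivWithin_le (s := univ)
      (fun x _ => (hc x).hasDerivWithinAt) (fun x _ => ?_) convex_univ (mem_univ _) (mem_univ _)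
    rw [norm_smul, hσn, one_mul]
    exact hM _
  have hu : ∀ t, HasDerivAt (fun t => -σ * potential P K (c t)) (‖v (c t)‖ ^ 2) t := by
    intro t
    have h1 := (hasGradientAt_potential P K m (c t)).hasFDerivAt.comp_hasDerivAt t (hc t)
    have h2 := h1.const_mul (-σ)
    refine h2.congr_deriv ?_
    rw [← gradField_eq, InnerProductSpace.toDual_apply_apply, inner_neg_left, inner_smul_right,
      real_inner_self_eq_norm_sq]
    linear_combination ‖v (c t)‖ ^ 2 * hσ
  obtain ⟨D, hD⟩ : ∃ D, ∀ y ∈ C, ‖-K * ∑ i, cos (y i) - ∑ i, alternating 0 (-P) i * y i‖ ≤ D :=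
    hC.exists_bound_of_continuousOn (by fun_prop)
  have hg0 : Tendsto (fun t => ‖v (c t)‖ ^ 2) atTop (𝓝 0) := by
    refine tendsto_deriv_zero_of_bounded (B := 2 * M * (L * M)) (C := D) hu
      (fun t => sq_nonneg _) (fun s t => ?_) (fun t ht => ?_)
    · have h1 : |‖v (c s)‖ - ‖v (c t)‖| ≤ L * (M * |s - t|) :=
        (abs_norm_sub_norm_le _ _).trans ((hL.norm_sub_le _ _).trans
          (mul_le_mul_of_nonneg_left (hclip s t) L.2))
      have h2 : |‖v (c s)‖ + ‖v (c t)‖| ≤ 2 * M := by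
        rw [abs_of_nonneg (by positivity)]; linarith [hM (c s), hM (c t)]
      rw [sq_sub_sq, abs_mul]
      calc _ ≤ 2 * M * (L * (M * |s - t|)) := by gcongr
        _ = _ := by ring
    · refine (le_abs_self _).trans ?_
      rw [abs_mul, abs_neg, ← Real.norm_eq_abs σ, hσn, one_mul, potential_eq hN P K m]
      exact hD _ (hin t ht)
  have hg : Tendsto (fun t => ‖v (c t)‖) atTop (𝓝 0) := by
    have := hg0.sqrt
    simpa [Real.sqrt_sq] using this
  have hcont : Continuous fun y : Fin N → ℝ => ‖(WithLp.toLp 2 (force P K y) : Config N)‖ := by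
    have := continuous_force (N := N) P K
    fun_prop
  rw [tendsto_def]
  intro U hU
  obtain ⟨U', hU'U, hU'o, hU'θ⟩ := mem_nhds_iff.1 hU
  have hcomp : IsCompact (C \ U') := hC.diff hU'o
  rcases (C \ U').eq_empty_or_nonempty with he | hne
  · filter_upwards [eventually_ge_atTop 0] with t ht
    by_contra hcon
    have : phaseDiff m (c t) ∈ C \ U' := ⟨hin t ht, fun h => hcon (hU'U h)⟩
    rw [he] at this
    exact this
  · obtain ⟨y, hy, hmin⟩ := hcomp.exists_isMinOn hne hcont.continuousOn
    have hpos : 0 < ‖(WithLp.toLp 2 (force P K y) : Config N)‖ := by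
      rw [norm_pos_iff]
      intro h0
      rw [WithLp.toLp_eq_zero] at h0
      exact hy.2 (hθ y hy.1 h0 ▸ hU'θ)
    filter_upwards [eventually_ge_atTop 0, hg.eventually_lt_const hpos] with t ht hlt
    by_contra hcon
    have hm : phaseDiff m (c t) ∈ C \ U' := ⟨hin t ht, fun h => hcon (hU'U h)⟩
    have := hmin hm
    simp only [mem_ofPred_eq, ← gradField_eq] at this
    exact absurd this (not_le.2 hlt)

/-- A trajectory whose phase differences stay in a compact set containing at most one
equilibrium converges to that equilibrium. -/
theorem tendsto_phaseDiff_atTop (hN : Even N) {P K : ℝ} {m : ℤ}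
    {C : Set (Fin N → ℝ)} (hC : IsCompact C) {θ : Fin N → ℝ}
    (hθ : ∀ y ∈ C, force P K y = 0 → y = θ) {γ : ℝ → Config N} (hγ : IsTrajectory P K γ)
    (hin : ∀ t, 0 ≤ t → phaseDiff m (γ t) ∈ C) :
    Tendsto (fun t => phaseDiff m (γ t)) atTop (𝓝 θ) :=
  tendsto_phaseDiff_of_mem_compact_aux hN hC hθ (σ := 1) (by norm_num)
    (fun t => by simpa using hγ t) hin

theorem tendsto_phaseDiff_atBot (hN : Even N) {P K : ℝ} {m : ℤ}
    {C : Set (Fin N → ℝ)} (hC : IsCompact C) {θ : Fin N → ℝ}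
    (hθ : ∀ y ∈ C, force P K y = 0 → y = θ) {γ : ℝ → Config N} (hγ : IsTrajectory P K γ)
    (hin : ∀ t, t ≤ 0 → phaseDiff m (γ t) ∈ C) :
    Tendsto (fun t => phaseDiff m (γ t)) atBot (𝓝 θ) := by
  have h := tendsto_phaseDiff_of_mem_compact_aux hN hC hθ (σ := -1) (by norm_num)
    (c := fun t => γ (-t)) (fun t => by simpa using isIntegralCurve_neg_time hγ t)
    (fun t ht => hin (-t) (by linarith))
  have := h.comp tendsto_neg_atBot_atTop
  simpa [Function.comp_def] using this

end Ring

/-! ### From the spectrum of J to the quadratic form of the Jacobian L. -/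

section Spectrum

open Polynomial

variable {N : ℕ} [NeZero N]

theorem lapL_apply (hN : 2 < N) (K : ℝ) (δ : Config N) (i k : Fin N) :
    lapL K δ i k = (if k = i then -(K * (cos (δ i - δ (i - 1)) + cos (δ (i + 1) - δ i))) else 0)
      + (if k = i - 1 then K * cos (δ i - δ (i - 1)) else 0)
      + (if k = i + 1 then K * cos (δ (i + 1) - δ i) else 0) := by
  have h1 := sub_one_ne_self (by omega : 1 < N) i
  have h2 := add_one_ne_self (by omega : 1 < N) i
  have h3 := sub_one_ne_add_one hN i
  have h4 : cos (δ i - δ (i + 1)) = cos (δ (i + 1) - δ i) := by rw [← cos_neg, neg_sub]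
  simp only [lapL, Matrix.of_apply, h4]
  by_cases hki : k = i
  · subst hki; simp [h1.symm, h2.symm]
  · by_cases hk1 : k = i - 1
    · subst hk1; simp [h1, h3]
    · simp [hki, hk1]

theorem lapL_mulVec (hN : 2 < N) (K : ℝ) (δ : Config N) (x : Fin N → ℝ) (i : Fin N) :
    (lapL K δ).mulVec x i = K * cos (δ (i + 1) - δ i) * (x (i + 1) - x i)
      - K * cos (δ i - δ (i - 1)) * (x i - x (i - 1)) := by
  simp only [Matrix.mulVec, dotProduct, lapL_apply hN, add_mul, ite_mul, zero_mul,
    Finset.sum_add_distrib, Finset.sum_ite_eq', Finset.mem_univ, if_true]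
  ring

theorem lapL_isHermitian (hN : 2 < N) (K : ℝ) (δ : Config N) : (lapL K δ).IsHermitian := by
  ext i k
  rw [Matrix.conjTranspose_apply, star_trivial, lapL_apply hN, lapL_apply hN]
  have e1 : (i = k) = (k = i) := propext eq_comm
  have e2 : (i = k - 1) = (k = i + 1) := propext (by rw [eq_sub_iff_add_eq, eq_comm])
  have e3 : (i = k + 1) = (k = i - 1) := propext (by rw [eq_sub_iff_add_eq, eq_comm])
  have t0 : (if k = i then -(K * (cos (δ k - δ (k - 1)) + cos (δ (k + 1) - δ k))) else 0)
      = if k = i then -(K * (cos (δ i - δ (i - 1)) + cos (δ (i + 1) - δ i))) else 0 := by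
    split_ifs with h
    · rw [h]
    · rfl
  have t1 : (if k = i + 1 then K * cos (δ k - δ (k - 1)) else 0)
      = if k = i + 1 then K * cos (δ (i + 1) - δ i) else 0 := by
    split_ifs with h
    · rw [h, add_sub_cancel_right]
    · rfl
  have t2 : (if k = i - 1 then K * cos (δ (k + 1) - δ k) else 0)
      = if k = i - 1 then K * cos (δ i - δ (i - 1)) else 0 := by
    split_ifs with h
    · rw [h, sub_add_cancel]
    · rfl
  simp only [e1, e2, e3]
  rw [t0, t1, t2]
  ring

/-- The bilinear form of the Jacobian `L`. -/
noncomputable def lapForm (K : ℝ) (δ x y : Config N) : ℝ :=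
  -K * ∑ i, cos (δ i - δ (i - 1)) * (x i - x (i - 1)) * (y i - y (i - 1))

theorem inner_lapL_mulVec (hN : 2 < N) (K : ℝ) (δ x y : Config N) :
    inner ℝ x (WithLp.toLp 2 ((lapL K δ).mulVec y) : Config N) = lapForm K δ x y := by
  have h := sum_sub_one fun i => K * cos (δ (i + 1) - δ i) * (y (i + 1) - y i) * x i
  simp only [sub_add_cancel] at h
  simp only [PiLp.inner_apply, RCLike.inner_apply, conj_trivial, lapL_mulVec hN, sub_mul,
    Finset.sum_sub_distrib]
  simp only [lapForm, Finset.mul_sum]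
  rw [← h, ← Finset.sum_sub_distrib]
  exact Finset.sum_congr rfl fun i _ => by ring

theorem lapForm_eigenvectorBasis (hN : 2 < N) (K : ℝ) (δ x : Config N) (i : Fin N) :
    lapForm K δ x ((lapL_isHermitian hN K δ).eigenvectorBasis i)
      = (lapL_isHermitian hN K δ).eigenvalues i *
        inner ℝ x ((lapL_isHermitian hN K δ).eigenvectorBasis i) := by
  rw [← inner_lapL_mulVec hN, Matrix.IsHermitian.mulVec_eigenvectorBasis, WithLp.toLp_smul,
    WithLp.toLp_ofLp, inner_smul_right]

theorem lapForm_comm (K : ℝ) (δ x y : Config N) : lapForm K δ x y = lapForm K δ y x := by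
  unfold lapForm
  congr 1
  exact Finset.sum_congr rfl fun i _ => by ring

theorem lapForm_self_eq_sum (hN : 2 < N) (K : ℝ) (δ x : Config N) :
    lapForm K δ x x = ∑ i, (lapL_isHermitian hN K δ).eigenvalues i *
      inner ℝ x ((lapL_isHermitian hN K δ).eigenvectorBasis i) ^ 2 := by
  set b := (lapL_isHermitian hN K δ).eigenvectorBasis
  rw [← inner_lapL_mulVec hN, ← b.sum_inner_mul_inner]
  refine Finset.sum_congr rfl fun i _ => ?_
  rw [inner_lapL_mulVec hN, lapForm_comm, lapForm_eigenvectorBasis hN]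
  ring

/-- The Schur complement of the block t I in t - J gives det (t - J) = det (t (t + α) - L). That
block is invertible for t > 0, and infinitely many values of t suffice for an identity of
polynomials. -/
theorem charpoly_jac (hN : 2 < N) (K α : ℝ) (δ : Config N) :
    (jac K α δ).charpoly =
      ∏ i, (X ^ 2 + C α * X - C ((lapL_isHermitian hN K δ).eigenvalues i)) := by
  refine Polynomial.eq_of_infinite_eval_eq _ _ ((Set.Ioi_infinite (0 : ℝ)).mono fun t ht => ?_)
  have ht0 : t ≠ 0 := ne_of_gt ht
  change eval t _ = eval t _
  rw [Matrix.eval_charpoly]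
  have hsplit : Matrix.scalar (Fin N ⊕ Fin N) t - jac K α δ
      = Matrix.fromBlocks (t • (1 : Matrix (Fin N) (Fin N) ℝ)) (-1) (-lapL K δ)
          ((t + α) • (1 : Matrix (Fin N) (Fin N) ℝ)) := by
    have hs : Matrix.scalar (Fin N ⊕ Fin N) t = Matrix.fromBlocks
        (t • (1 : Matrix (Fin N) (Fin N) ℝ)) 0 0 (t • (1 : Matrix (Fin N) (Fin N) ℝ)) := by
      ext (i | i) (k | k) <;> simp [Matrix.diagonal_apply, Matrix.one_apply]
    rw [jac, hs, sub_eq_add_neg, Matrix.fromBlocks_neg, Matrix.fromBlocks_add]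
    simp [add_smul]
  let _ : Invertible (t • (1 : Matrix (Fin N) (Fin N) ℝ)) :=
    ⟨t⁻¹ • 1, by simp [ht0], by simp [ht0]⟩
  have hinv : ⅟(t • (1 : Matrix (Fin N) (Fin N) ℝ)) = t⁻¹ • 1 := rfl
  rw [hsplit, Matrix.det_fromBlocks₁₁, hinv, ← Matrix.det_mul]
  have hm : (t • (1 : Matrix (Fin N) (Fin N) ℝ)) *
      ((t + α) • 1 - -lapL K δ * t⁻¹ • 1 * -1) = Matrix.scalar (Fin N) (t * (t + α)) - lapL K δ := by
    rw [Matrix.scalar_apply, ← Matrix.smul_one_eq_diagonal]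
    simp only [mul_neg, mul_one, neg_mul, neg_neg, Matrix.smul_mul, Matrix.mul_smul, one_mul,
      smul_sub, smul_smul, mul_inv_cancel₀ ht0, one_smul]
  rw [hm, ← Matrix.eval_charpoly, (lapL_isHermitian hN K δ).charpoly_eq, eval_prod, eval_prod]
  refine Finset.prod_congr rfl fun i _ => ?_
  simp
  ring

theorem exists_roots_quadratic (α l : ℝ) : ∃ r₁ r₂ : ℂ, r₁ + r₂ = -α ∧ r₁ * r₂ = -l ∧
    (X ^ 2 + C (α : ℂ) * X - C (l : ℂ)).roots = {r₁, r₂} := by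
  obtain ⟨z, hz⟩ := IsAlgClosed.exists_pow_nat_eq ((α : ℂ) ^ 2 + 4 * l) two_pos
  have h1 : (-α + z) / 2 + (-α - z) / 2 = -(α : ℂ) := by ring
  have h2 : (-α + z) / 2 * ((-α - z) / 2) = -(l : ℂ) := by linear_combination (-1 / 4 : ℂ) * hz
  refine ⟨(-α + z) / 2, (-α - z) / 2, h1, h2, ?_⟩
  generalize (-α + z) / 2 = r₁ at h1 h2 ⊢
  generalize (-α - z) / 2 = r₂ at h1 h2 ⊢
  have h3 : (X ^ 2 + C (α : ℂ) * X - C (l : ℂ))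
      = (({r₁, r₂} : Multiset ℂ).map fun a => X - C a).prod := by
    simp only [Multiset.insert_eq_cons, Multiset.map_cons, Multiset.map_singleton,
      Multiset.prod_cons, Multiset.prod_singleton]
    rw [← neg_eq_iff_eq_neg] at h1 h2
    rw [← h1, ← h2]
    simp only [C_neg, C_add, C_mul]
    ring
  rw [h3, Polynomial.roots_multiset_prod_X_sub_C]

theorem eigenvaluesJ_eq (hN : 2 < N) (K α : ℝ) (δ : Config N) :
    eigenvaluesJ K α δ = ∑ i, (X ^ 2 + C (α : ℂ) * X -
      C (((lapL_isHermitian hN K δ).eigenvalues i : ℝ) : ℂ)).roots := by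
  unfold eigenvaluesJ
  have h1 : ((jac K α δ).map Complex.ofReal) = (jac K α δ).map Complex.ofRealHom := rfl
  rw [h1, Matrix.charpoly_map, charpoly_jac hN, Polynomial.map_prod]
  simp only [Polynomial.map_sub, Polynomial.map_add, Polynomial.map_mul, Polynomial.map_pow,
    Polynomial.map_X, Polynomial.map_C, Complex.ofRealHom_eq_coe]
  rw [Polynomial.roots_prod]
  · rfl
  · refine Finset.prod_ne_zero_iff.2 fun i _ => ?_
    have : (X ^ 2 + C (α : ℂ) * X -
      C (((lapL_isHermitian hN K δ).eigenvalues i : ℝ) : ℂ)).Monic := by monicity!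
    exact this.ne_zero

theorem re_roots_quadratic {α l : ℝ} {r₁ r₂ : ℂ} (h1 : r₁ + r₂ = -α) (h2 : r₁ * r₂ = -l) :
    r₁.re + r₂.re = -α ∧ r₁.re * r₂.re + r₁.im ^ 2 = -l ∧ r₂.im = -r₁.im ∧
      (r₁.im = 0 ∨ r₁.re = r₂.re) := by
  have a1 := congrArg Complex.re h1
  have a2 := congrArg Complex.im h1
  have a3 := congrArg Complex.re h2
  have a4 := congrArg Complex.im h2
  simp only [Complex.add_re, Complex.add_im, Complex.mul_re, Complex.mul_im, Complex.neg_re,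
    Complex.neg_im, Complex.ofReal_re, Complex.ofReal_im] at a1 a2 a3 a4
  have e : r₂.im = -r₁.im := by linarith
  rw [e] at a3 a4
  refine ⟨a1, by linarith, e, ?_⟩
  have : r₁.im * (r₂.re - r₁.re) = 0 := by linarith
  rcases mul_eq_zero.1 this with h | h
  · exact Or.inl h
  · exact Or.inr (by linarith)

open Classical in
-- The roots have sum -α < 0 and product -l. They are either both real, with opposite signs exactly
-- when l > 0, or have common real part -α/2.
theorem countP_roots_quadratic {α : ℝ} (hα : 0 < α) (l : ℝ) :
    (X ^ 2 + C (α : ℂ) * X - C (l : ℂ)).roots.countP (fun μ : ℂ => 0 < μ.re)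
      = if 0 < l then 1 else 0 := by
  obtain ⟨r₁, r₂, h1, h2, hr⟩ := exists_roots_quadratic α l
  obtain ⟨a1, a2, a3, a4⟩ := re_roots_quadratic h1 h2
  rw [hr, Multiset.insert_eq_cons, Multiset.countP_cons, ← Multiset.cons_zero,
    Multiset.countP_cons, Multiset.countP_zero]
  rcases a4 with h | h
  · rw [h] at a2
    split_ifs with p1 p2 p3 <;> first | rfl | (exfalso; nlinarith)
  · have q1 : ¬0 < r₁.re := by linarith
    have q2 : ¬0 < r₂.re := by linarith
    have q3 : ¬0 < l := by nlinarith [sq_nonneg r₁.im, sq_nonneg r₁.re]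
    simp [q1, q2, q3]

open Classical in
theorem count_zero_roots_quadratic {α : ℝ} (hα : 0 < α) (l : ℝ) :
    (X ^ 2 + C (α : ℂ) * X - C (l : ℂ)).roots.count 0 = if l = 0 then 1 else 0 := by
  obtain ⟨r₁, r₂, h1, h2, hr⟩ := exists_roots_quadratic α l
  have hαc : (α : ℂ) ≠ 0 := by exact_mod_cast hα.ne'
  rw [hr, Multiset.insert_eq_cons, Multiset.count_cons, Multiset.count_singleton]
  by_cases hl : l = 0
  · subst hl
    rw [Complex.ofReal_zero, neg_zero] at h2
    rcases mul_eq_zero.1 h2 with h | h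
    · subst h
      have : (0 : ℂ) ≠ r₂ := by
        rintro rfl
        apply hαc
        simpa using h1.symm
      simp [this]
    · subst h
      have : (0 : ℂ) ≠ r₁ := by
        rintro rfl
        apply hαc
        simpa using h1.symm
      simp [this]
  · have hlc : (l : ℂ) ≠ 0 := by exact_mod_cast hl
    have p1 : (0 : ℂ) ≠ r₁ := by
      rintro rfl; apply hlc; simpa using h2.symm
    have p2 : (0 : ℂ) ≠ r₂ := by
      rintro rfl; apply hlc; simpa using h2.symm
    simp [p1, p2, hl]

theorem re_neg_of_mem_roots_quadratic {α l : ℝ} (hα : 0 < α) (hl : l ≤ 0) {μ : ℂ}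
    (hμ : μ ∈ (X ^ 2 + C (α : ℂ) * X - C (l : ℂ)).roots) (h0 : μ ≠ 0) : μ.re < 0 := by
  obtain ⟨r₁, r₂, h1, h2, hr⟩ := exists_roots_quadratic α l
  have key : ∀ r₁ r₂ : ℂ, r₁ + r₂ = -α → r₁ * r₂ = -l → r₁ ≠ 0 → r₁.re < 0 := by
    intro r₁ r₂ h1 h2 h0
    obtain ⟨a1, a2, a3, a4⟩ := re_roots_quadratic h1 h2
    rcases a4 with h | h
    · rw [h] at a2
      rcases lt_trichotomy r₁.re 0 with hc | hc | hc
      · exact hc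
      · exact absurd (Complex.ext hc h) h0
      · nlinarith
    · linarith
  rw [hr, Multiset.insert_eq_cons, Multiset.mem_cons, Multiset.mem_singleton] at hμ
  rcases hμ with rfl | rfl
  · exact key _ _ h1 h2 h0
  · exact key _ _ (by rw [add_comm]; exact h1) (by rw [mul_comm]; exact h2) h0

open Classical in
theorem countP_eigenvaluesJ (hN : 2 < N) (K : ℝ) {α : ℝ} (hα : 0 < α) (δ : Config N) :
    (eigenvaluesJ K α δ).countP (fun μ => 0 < μ.re)
      = (Finset.univ.filter fun i => 0 < (lapL_isHermitian hN K δ).eigenvalues i).card := by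
  rw [eigenvaluesJ_eq hN, ← Multiset.coe_countPAddMonoidHom, map_sum]
  simp only [Multiset.coe_countPAddMonoidHom, countP_roots_quadratic hα]
  rw [Finset.card_filter]

open Classical in
theorem count_zero_eigenvaluesJ (hN : 2 < N) (K : ℝ) {α : ℝ} (hα : 0 < α) (δ : Config N) :
    (eigenvaluesJ K α δ).count 0
      = (Finset.univ.filter fun i => (lapL_isHermitian hN K δ).eigenvalues i = 0).card := by
  rw [eigenvaluesJ_eq hN, ← Multiset.coe_countAddMonoidHom, map_sum]
  simp only [Multiset.coe_countAddMonoidHom, count_zero_roots_quadratic hα]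
  rw [Finset.card_filter]

/-- Equilibria with all line angles below `π/2` are stable. -/
theorem isStableEquilibrium_of_cos_pos (hN : 2 < N) {P K α : ℝ} (hK : 0 < K) (hα : 0 < α)
    {δ : Config N} (heq : IsEquilibrium P K δ) (hcos : ∀ i, 0 < cos (δ i - δ (i - 1))) :
    IsStableEquilibrium P K α δ := by
  classical
  set hL := lapL_isHermitian hN K δ
  set b := hL.eigenvectorBasis
  have hterm : ∀ (x : Config N) i, 0 ≤ cos (δ i - δ (i - 1)) * (x i - x (i - 1)) * (x i - x (i - 1)) :=
    fun x i => by rw [mul_assoc]; exact mul_nonneg (hcos i).le (mul_self_nonneg _)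
  have hform : ∀ x : Config N, lapForm K δ x x ≤ 0 := fun x => by
    have := mul_nonneg hK.le (Finset.sum_nonneg fun i (_ : i ∈ Finset.univ) => hterm x i)
    unfold lapForm
    linarith
  have hev : ∀ i, hL.eigenvalues i = lapForm K δ (b i) (b i) := fun i => by
    rw [lapForm_eigenvectorBasis hN, real_inner_self_eq_norm_sq]
    simp [b]
  have hle : ∀ i, hL.eigenvalues i ≤ 0 := fun i => by rw [hev]; exact hform _
  -- All terms of the form have one sign, so at a null vector every difference along a line
  -- vanishes.
  have hconst : ∀ i, hL.eigenvalues i = 0 → ∀ k, b i k = b i 0 := by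
    intro i hi k
    rw [hev, lapForm, mul_eq_zero] at hi
    have hs := hi.resolve_left (by linarith)
    rw [Finset.sum_eq_zero_iff_of_nonneg fun k _ => hterm (b i) k] at hs
    refine eq_const_of_add_one (f := fun k => b i k) (fun k => ?_) k 0
    have := hs (k + 1) (Finset.mem_univ _)
    rw [mul_assoc, mul_eq_zero, mul_self_eq_zero, add_sub_cancel_right] at this
    have h2 := hcos (k + 1)
    rw [add_sub_cancel_right] at h2
    exact sub_eq_zero.1 (this.resolve_left h2.ne')
  have hcard : (Finset.univ.filter fun i => hL.eigenvalues i = 0).card = 1 := by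
    apply le_antisymm
    -- Two null eigenvectors of the basis would be constant, of norm one and orthogonal, which is
    -- impossible.
    · rw [Finset.card_le_one]
      intro i hi k hk
      by_contra hne
      have ci := hconst i (Finset.mem_filter.1 hi).2
      have ck := hconst k (Finset.mem_filter.1 hk).2
      have horth : inner ℝ (b i) (b k) = 0 := b.orthonormal.2 hne
      have hni : inner ℝ (b i) (b i) = (1 : ℝ) := by rw [real_inner_self_eq_norm_sq]; simp
      have hnk : inner ℝ (b k) (b k) = (1 : ℝ) := by rw [real_inner_self_eq_norm_sq]; simp
      simp only [PiLp.inner_apply, RCLike.inner_apply, conj_trivial, ci, ck, Finset.sum_const,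
        Finset.card_univ, Fintype.card_fin, nsmul_eq_mul] at horth hni hnk
      have : (N : ℝ) * (b i 0 * b i 0) * (N * (b k 0 * b k 0)) = 0 := by
        linear_combination N * (b i 0 * b k 0) * horth
      rw [hni, hnk] at this
      norm_num at this
    · rw [Nat.one_le_iff_ne_zero, Ne, Finset.card_eq_zero]
      intro hempty
      have hneg : ∀ i, hL.eigenvalues i ≠ 0 := fun i hi => by
        have : i ∈ (Finset.univ.filter fun i => hL.eigenvalues i = 0) := by simp [hi]
        rw [hempty] at this
        simp at this
      set x : Config N := WithLp.toLp 2 fun _ => 1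
      have h0 : lapForm K δ x x = 0 := by simp [lapForm, x]
      rw [lapForm_self_eq_sum hN, Finset.sum_eq_zero_iff_of_nonpos fun i _ =>
        mul_nonpos_of_nonpos_of_nonneg (hle i) (sq_nonneg _)] at h0
      have h1 : inner ℝ x x = (0 : ℝ) := by
        rw [← b.sum_inner_mul_inner]
        refine Finset.sum_eq_zero fun i _ => ?_
        have h2 := (mul_eq_zero.1 (h0 i (Finset.mem_univ i))).resolve_left (hneg i)
        have h3 : inner ℝ x (b i) = (0 : ℝ) := by simpa using h2
        rw [h3, zero_mul]
      have h4 := congrFun (congrArg WithLp.ofLp (inner_self_eq_zero.1 h1)) (0 : Fin N)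
      simp [x] at h4
  refine ⟨heq, ?_, ?_⟩
  · rw [count_zero_eigenvaluesJ hN K hα]
    exact hcard
  · intro μ hμ h0
    rw [eigenvaluesJ_eq hN, Multiset.mem_sum] at hμ
    obtain ⟨i, -, hi⟩ := hμ
    exact re_neg_of_mem_roots_quadratic hα (hle i) hi h0

/-- Equilibria at which exactly one line angle exceeds `π/2`, sufficiently far, are type-1. -/
theorem isTypeEquilibrium_one (hN : 2 < N) {P K α : ℝ} (hK : 0 < K) (hα : 0 < α)
    {δ : Config N} (heq : IsEquilibrium P K δ) {j : Fin N}
    (hcos : ∀ i, i ≠ j → 0 ≤ cos (δ i - δ (i - 1))) {x : Config N} (hx : 0 < lapForm K δ x x) :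
    IsTypeEquilibrium P K α 1 δ := by
  classical
  set hL := lapL_isHermitian hN K δ with hLd
  set b := hL.eigenvectorBasis with hb
  refine ⟨heq, ?_⟩
  rw [countP_eigenvaluesJ hN K hα]
  have hform : ∀ y : Config N, y j - y (j - 1) = 0 → lapForm K δ y y ≤ 0 := by
    intro y hy
    have : 0 ≤ ∑ i, cos (δ i - δ (i - 1)) * (y i - y (i - 1)) * (y i - y (i - 1)) := by
      refine Finset.sum_nonneg fun i _ => ?_
      by_cases hij : i = j
      · subst hij; simp [hy]
      · rw [mul_assoc]; exact mul_nonneg (hcos i hij) (mul_self_nonneg _)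
    have := mul_nonneg hK.le this
    unfold lapForm
    linarith
  have hnorm : ∀ i, inner ℝ (b i) (b i) = (1 : ℝ) := fun i => by
    rw [real_inner_self_eq_norm_sq]; simp
  have hev : ∀ i, lapForm K δ (b i) (b i) = hL.eigenvalues i := fun i => by
    rw [hb, lapForm_eigenvectorBasis hN, ← hb, hnorm, mul_one]
  apply le_antisymm
  · rw [Finset.card_le_one]
    intro i hi k hk
    by_contra hne
    have pi : 0 < hL.eigenvalues i := (Finset.mem_filter.1 hi).2
    have pk : 0 < hL.eigenvalues k := (Finset.mem_filter.1 hk).2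
    have horth : inner ℝ (b i) (b k) = (0 : ℝ) := b.orthonormal.2 hne
    -- With these coefficients p b_i - q b_k has equal entries at j and j - 1. On that hyperplane
    -- the form is nonpositive, whereas two positive eigenvalues would make it positive. The case q
    -- = 0 needs b_i alone.
    set p := b k j - b k (j - 1) with hp
    set q := b i j - b i (j - 1) with hq
    have h1 : lapForm K δ (p • b i - q • b k) (p • b i - q • b k)
        = p ^ 2 * hL.eigenvalues i + q ^ 2 * hL.eigenvalues k := by
      have e1 : lapForm K δ (p • b i - q • b k) (p • b i - q • b k)
          = p ^ 2 * lapForm K δ (b i) (b i) + q ^ 2 * lapForm K δ (b k) (b k)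
            - 2 * p * q * lapForm K δ (b i) (b k) := by
        simp only [lapForm, Finset.mul_sum]
        rw [← Finset.sum_add_distrib, ← Finset.sum_sub_distrib]
        refine Finset.sum_congr rfl fun l _ => ?_
        simp only [PiLp.sub_apply, PiLp.smul_apply, smul_eq_mul]
        ring
      have e2 : lapForm K δ (b i) (b k) = 0 := by
        rw [hb, lapForm_eigenvectorBasis hN, ← hb, horth, mul_zero]
      rw [e1, e2, hev, hev]
      ring
    have h2 := hform (p • b i - q • b k) (by
      simp only [PiLp.sub_apply, PiLp.smul_apply, smul_eq_mul]
      rw [hp, hq]; ring)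
    rw [h1] at h2
    have hq0 : q = 0 := by
      by_contra hq0
      have : 0 < q ^ 2 := by positivity
      nlinarith [sq_nonneg p]
    have h3 := hform (b i) hq0
    rw [hev] at h3
    linarith
  · rw [Nat.one_le_iff_ne_zero, Ne, Finset.card_eq_zero]
    intro hempty
    have hle : ∀ i, hL.eigenvalues i ≤ 0 := fun i => by
      by_contra hi
      have : i ∈ (Finset.univ.filter fun i => 0 < hL.eigenvalues i) := by simpa using hi
      rw [hempty] at this
      simp at this
    rw [lapForm_self_eq_sum hN] at hx
    exact absurd hx (not_lt.2 (Finset.sum_nonpos fun i _ =>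
      mul_nonpos_of_nonpos_of_nonneg (hle i) (sq_nonneg _)))

end Spectrum

/-! ### Angles of the equilibria: existence, uniqueness, stability and type. -/

section Angles

theorem sin_sign_mul_pi_sub {s : ℝ} (hs : s = 1 ∨ s = -1) (x : ℝ) : sin (s * π - x) = sin x := by
  rcases hs with rfl | rfl
  · rw [one_mul, sin_pi_sub]
  · rw [show -1 * π - x = -(x + π) by ring, sin_neg, sin_add_pi, neg_neg]

theorem cos_sign_mul_pi_sub {s : ℝ} (hs : s = 1 ∨ s = -1) (x : ℝ) :
    cos (s * π - x) = -cos x := by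
  rcases hs with rfl | rfl
  · rw [one_mul, cos_pi_sub]
  · rw [show -1 * π - x = -(x + π) by ring, cos_neg, cos_add_pi]

variable {N : ℕ}

theorem sin_saddle {s : ℝ} (hs : s = 1 ∨ s = -1) (a b : ℝ) (j i : Fin N) :
    sin (saddle s a b j i) = sin (alternating a b i) := by
  by_cases h : i = j
  · rw [h, saddle_same, sin_sign_mul_pi_sub hs]
  · rw [saddle_of_ne _ _ _ h]

theorem hatAngle_mul (hN2 : 2 < N) (m : ℤ) (s : ℝ) :
    ((N : ℝ) - 2) * hatAngle N m s = (2 * m - s) * π := by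
  have : (2 : ℝ) < N := by exact_mod_cast hN2
  unfold hatAngle
  field_simp [show (N : ℝ) - 2 ≠ 0 by linarith]

variable [NeZero N]

/-- The alternating power is absorbed into the sines of an alternating reference state; what remains
is a discrete gradient, as for P = 0. -/
theorem force_eq_of_balance (hN : Even N) {P K a b : ℝ} (hK : 0 < K)
    (hab : sin a - sin b = P / K) (θ : Fin N → ℝ) (i : Fin N) :
    force P K θ i = K * ((sin (θ (i + 1)) - sin (alternating a b (i + 1)))
      - (sin (θ i) - sin (alternating a b i))) := by
  have hP : P = K * (sin a - sin b) := by rw [hab]; field_simp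
  rw [force, power_eq_alternating, alternating_add_one hN, hP]
  unfold alternating
  split_ifs <;> ring

theorem force_eq_zero_of_sin_eq (hN : Even N) {P K a b : ℝ} (hK : 0 < K)
    (hab : sin a - sin b = P / K) {θ : Fin N → ℝ}
    (h : ∀ i, sin (θ i) = sin (alternating a b i)) : force P K θ = 0 := by
  funext i
  rw [force_eq_of_balance hN hK hab, h, h]
  simp

/-- The angle 2πm/N is the convex combination of θ̂ and sπ/2 with weights (N - 2)/N and 2/N. -/
theorem abs_winding_lt (hN2 : 2 < N) {m : ℤ} {s : ℝ} (hs : s = 1 ∨ s = -1)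
    (hm : |hatAngle N m s| < π / 2) : |2 * π * m / N| < π / 2 := by
  have h2 : (2 : ℝ) < N := by exact_mod_cast hN2
  have h := hatAngle_mul hN2 m s
  have hm' := abs_lt.1 hm
  have e : 2 * π * m / N * N = 2 * π * m := by field_simp
  rw [abs_lt]
  rcases hs with rfl | rfl <;> constructor <;> nlinarith [pi_pos, hm'.1, hm'.2]

/-- The bound on P keeps the argument of the arcsine below cos φ = sin (π/2 - |φ|), where φ = 2πm/N.
Hence both angles φ ± arcsin(…) stay inside (-π/2, π/2). -/
theorem isStableEquilibrium_syncState (hN : Even N) (hN2 : 2 < N) {P K : ℝ} {m : ℤ} (hK : 0 < K)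
    (hφ : |2 * π * m / N| < π / 2) (hP : |P| / K < 2 * cos (2 * π * m / N) ^ 2) {δ : Config N}
    (hδ : phaseDiff m δ = syncState N m P K) {α : ℝ} (hα : 0 < α) :
    IsStableEquilibrium P K α δ := by
  set φ : ℝ := 2 * π * m / N with hφd
  have hc : 0 < cos φ := cos_pos_of_mem_Ioo ⟨(abs_lt.1 hφ).1, (abs_lt.1 hφ).2⟩
  have hc1 := cos_le_one φ
  set y := P / (2 * K * cos φ) with hy
  have hyP : 2 * cos φ * y = P / K := by rw [hy]; field_simp
  have hylt : |y| < cos φ := by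
    have : 2 * cos φ * |y| < 2 * cos φ * cos φ := by
      rw [← abs_of_pos (show 0 < 2 * cos φ by linarith), ← abs_mul,
        abs_of_pos (show 0 < 2 * cos φ by linarith), hyP, abs_div, abs_of_pos hK]
      linarith
    exact lt_of_mul_lt_mul_left this (by linarith)
  have hy1 := abs_lt.1 hylt
  have hcs : sin (π / 2 - |φ|) = cos φ := by rw [sin_pi_div_two_sub, cos_abs]
  have harc : ∀ z, |z| < cos φ → arcsin z < π / 2 - |φ| := by
    intro z hz
    have hz' := abs_lt.1 hz
    rw [arcsin_lt_iff_lt_sin ⟨by linarith, by linarith⟩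
      ⟨by linarith [pi_pos], by linarith [abs_nonneg φ]⟩, hcs]
    exact hz'.2
  have hx : |arcsin y| < π / 2 - |φ| := by
    rw [abs_lt]
    refine ⟨?_, harc y hylt⟩
    have := harc (-y) (by rwa [abs_neg])
    rw [arcsin_neg] at this
    linarith
  have hx' := abs_lt.1 hx
  have hφ' := abs_le.1 (le_refl |φ|)
  refine isStableEquilibrium_of_cos_pos hN2 hK hα ?_ fun i => ?_
  · rw [isEquilibrium_iff (m := m), hδ]
    refine force_eq_zero_of_sin_eq hN hK ?_ fun i => rfl
    rw [sin_add, sin_add, sin_neg, cos_neg, sin_arcsin (by linarith) (by linarith)]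
    linarith
  · rw [← cos_phaseDiff m, hδ]
    apply cos_pos_of_mem_Ioo
    unfold syncState alternating
    split_ifs <;> constructor <;> linarith

theorem isEquilibrium_saddle (hN : Even N) {P K : ℝ} {m : ℤ} {s : ℝ} (hs : s = 1 ∨ s = -1)
    (hK : 0 < K) {a b : ℝ} (hab : sin a - sin b = P / K) {j : Fin N} {δ : Config N}
    (hδ : phaseDiff m δ = saddle s a b j) : IsEquilibrium P K δ := by
  rw [isEquilibrium_iff (m := m), hδ]
  exact force_eq_zero_of_sin_eq hN hK hab fun i => sin_saddle hs a b j i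

/-- The test vector e_{j-1} - e_j has difference -2 across line j and 1 across its two neighbours.
Since the cosine at j is negated, the form there equals K (4 cos τ_j - 2 cos τ_{j+1}), positive by
the comparison of the cosines. -/
theorem isTypeEquilibrium_saddle (hN : Even N) (hN2 : 2 < N) {P K : ℝ} {m : ℤ} {s : ℝ}
    (hs : s = 1 ∨ s = -1) (hK : 0 < K) {a b : ℝ} (hab : sin a - sin b = P / K)
    (ha : 0 < cos a) (hb : 0 < cos b) (hca : cos b < 2 * cos a) (hcb : cos a < 2 * cos b)
    {j : Fin N} {δ : Config N} (hδ : phaseDiff m δ = saddle s a b j) {α : ℝ} (hα : 0 < α) :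
    IsTypeEquilibrium P K α 1 δ := by
  have hcos : ∀ i, cos (δ i - δ (i - 1)) = cos (saddle s a b j i) := fun i => by
    rw [← cos_phaseDiff m, hδ]
  have h1 := sub_one_ne_self (by omega : 1 < N) j
  have h2 := add_one_ne_self (by omega : 1 < N) j
  have h3 := sub_one_ne_add_one hN2 j
  refine isTypeEquilibrium_one hN2 hK hα (isEquilibrium_saddle hN hs hK hab hδ) (j := j)
    (x := WithLp.toLp 2 fun i => (if i = j - 1 then 1 else 0) - (if i = j then 1 else 0)) ?_ ?_
  · intro i hi
    rw [hcos, saddle_of_ne _ _ _ hi]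
    unfold alternating
    split_ifs
    · exact ha.le
    · exact hb.le
  · unfold lapForm
    have hd : ∀ i : Fin N, cos (δ i - δ (i - 1)) *
        ((if i = j - 1 then (1 : ℝ) else 0) - (if i = j then 1 else 0) -
          ((if i - 1 = j - 1 then 1 else 0) - (if i - 1 = j then 1 else 0))) *
        ((if i = j - 1 then (1 : ℝ) else 0) - (if i = j then 1 else 0) -
          ((if i - 1 = j - 1 then 1 else 0) - (if i - 1 = j then 1 else 0)))
        = (if i = j - 1 then cos (saddle s a b j i) else 0)
          + (if i = j then 4 * cos (saddle s a b j i) else 0)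
          + (if i = j + 1 then cos (saddle s a b j i) else 0) := by
      intro i
      rw [hcos]
      simp only [sub_eq_iff_eq_add]
      by_cases e1 : i = j - 1
      · subst e1; simp [h1, h3]
      · by_cases e2 : i = j
        · subst e2; simp [h1.symm, h2.symm]; ring
        · by_cases e3 : i = j + 1
          · subst e3; simp [h2, h3.symm]
          · simp [e1, e2, e3]
    simp only [hd, Finset.sum_add_distrib, Finset.sum_ite_eq', Finset.mem_univ, if_true]
    rw [saddle_same, saddle_of_ne _ _ _ h1, saddle_of_ne _ _ _ h2, cos_sign_mul_pi_sub hs,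
      alternating_sub_one hN, alternating_add_one hN]
    have : 0 < 4 * cos (alternating a b j) - 2 * cos (alternating b a j) := by
      unfold alternating
      split_ifs <;> linarith
    have := mul_pos hK this
    linarith

/-- Along the line A a + B b = const an increase of a cannot increase b, so sin a - sin b strictly
increases. The case A = 0 is needed for N = 4. -/
theorem balanced_angles_unique {A B a b a' b' : ℝ} (hA : 0 ≤ A) (hB : 0 < B)
    (ha : a ∈ Ioo (-(π / 2)) (π / 2)) (hb : b ∈ Ioo (-(π / 2)) (π / 2))
    (ha' : a' ∈ Ioo (-(π / 2)) (π / 2)) (hb' : b' ∈ Ioo (-(π / 2)) (π / 2))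
    (hsum : A * a + B * b = A * a' + B * b') (hsin : sin a - sin b = sin a' - sin b') :
    a = a' ∧ b = b' := by
  have key : ∀ a b a' b' : ℝ, a ∈ Ioo (-(π / 2)) (π / 2) → b ∈ Ioo (-(π / 2)) (π / 2) →
      a' ∈ Ioo (-(π / 2)) (π / 2) → b' ∈ Ioo (-(π / 2)) (π / 2) →
      A * a + B * b = A * a' + B * b' → sin a - sin b = sin a' - sin b' → ¬a < a' := by
    intro a b a' b' ha hb ha' hb' hsum hsin hlt
    have hbb : b' ≤ b := by
      have : B * b' ≤ B * b := by nlinarith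
      exact le_of_mul_le_mul_left this hB
    have h1 := strictMonoOn_sin (Ioo_subset_Icc_self ha) (Ioo_subset_Icc_self ha') hlt
    have h2 := strictMonoOn_sin.monotoneOn (Ioo_subset_Icc_self hb') (Ioo_subset_Icc_self hb) hbb
    linarith
  have haa : a = a' := le_antisymm (not_lt.1 (key _ _ _ _ ha' hb' ha hb hsum.symm hsin.symm))
    (not_lt.1 (key _ _ _ _ ha hb ha' hb' hsum hsin))
  refine ⟨haa, ?_⟩
  subst haa
  exact mul_left_cancel₀ hB.ne' (by linarith)

/-- On the line through (h, h), parametrised by (h + B x, h - A x), the difference of sines is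
negative at one end and positive at the other. The intermediate value theorem applies, and ε depends
only on A, B, h and η. -/
theorem exists_balanced_angles {A B h η : ℝ} (hA : 0 ≤ A) (hB : 0 < B) (hη : 0 < η)
    (hl : -(π / 2) ≤ h - η) (hu : h + η ≤ π / 2) :
    ∃ ε > 0, ∀ p : ℝ, |p| < ε → ∃ a b, |a - h| ≤ η ∧ |b - h| ≤ η ∧
      A * a + B * b = (A + B) * h ∧ sin a - sin b = p := by
  have hAB : 0 < A + B := by linarith
  set r := η / (A + B) with hr
  have hr0 : 0 < r := by positivity
  have hrη : (A + B) * r = η := by rw [hr]; field_simp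
  have hBr : 0 < B * r := by positivity
  have hAr : 0 ≤ A * r := by positivity
  set F : ℝ → ℝ := fun x => sin (h + B * x) - sin (h - A * x) with hF
  have hpos : 0 < F r := by
    have h1 : sin h < sin (h + B * r) := strictMonoOn_sin ⟨by linarith, by linarith⟩
      ⟨by linarith, by nlinarith⟩ (by linarith)
    have h2 : sin (h - A * r) ≤ sin h := strictMonoOn_sin.monotoneOn ⟨by nlinarith, by linarith⟩
      ⟨by linarith, by linarith⟩ (by linarith)
    simp only [hF]; linarith
  have hneg : F (-r) < 0 := by
    have h1 : sin (h + B * -r) < sin h := strictMonoOn_sin ⟨by nlinarith, by linarith⟩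
      ⟨by linarith, by linarith⟩ (by linarith)
    have h2 : sin h ≤ sin (h - A * -r) := strictMonoOn_sin.monotoneOn
      ⟨by linarith, by linarith⟩ ⟨by linarith, by nlinarith⟩ (by linarith)
    simp only [hF]; linarith
  refine ⟨min (F r) (-F (-r)), lt_min hpos (by linarith), fun p hp => ?_⟩
  have hp1 := abs_lt.1 (hp.trans_le (min_le_left _ _))
  have hp2 := abs_lt.1 (hp.trans_le (min_le_right _ _))
  obtain ⟨x, hx, hxp⟩ := intermediate_value_Icc (show -r ≤ r by linarith)
    (f := F) (by fun_prop) (show p ∈ Icc (F (-r)) (F r) from ⟨by linarith, by linarith⟩)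
  have hxr : |x| ≤ r := abs_le.2 hx
  refine ⟨h + B * x, h - A * x, ?_, ?_, by ring, hxp⟩
  · rw [add_sub_cancel_left, abs_mul, abs_of_pos hB]
    nlinarith [abs_nonneg x]
  · rw [sub_sub_cancel_left, abs_neg, abs_mul, abs_of_nonneg hA]
    nlinarith [abs_nonneg x]

/-- The exceptional place turns two of the N/2 copies' worth of its own angle around, so the winding
condition becomes linear with coefficients N - 4 and N, both nonnegative as N is even and greater
than 2. -/
theorem isSaddleAngles_iff (hN : Even N) (hN2 : 2 < N) {P K : ℝ} {m : ℤ} {s : ℝ} {j : Fin N}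
    {a b : ℝ} : IsSaddleAngles P K m s j a b ↔
      a ∈ Ioo (-(π / 2)) (π / 2) ∧ b ∈ Ioo (-(π / 2)) (π / 2) ∧ sin a - sin b = P / K ∧
      (if Even (j : ℕ) then ((N : ℝ) - 4) * a + N * b else N * a + ((N : ℝ) - 4) * b)
        = (2 * N - 4) * hatAngle N m s := by
  unfold IsSaddleAngles
  rw [sum_saddle hN]
  have h := hatAngle_mul hN2 m s
  unfold alternating
  refine and_congr_right fun _ => and_congr_right fun _ => and_congr_right fun _ => ?_
  split_ifs <;> constructor <;> intro h' <;> linarith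

/-- Existence, uniqueness and smallness of the saddle angles for small `P / K`. -/
theorem exists_saddleAngles (hN : Even N) (hN2 : 2 < N) {m : ℤ} {s : ℝ} {η : ℝ} (hη : 0 < η)
    (hl : -(π / 2) < hatAngle N m s - η) (hu : hatAngle N m s + η < π / 2) :
    ∃ ε > 0, ∀ P K : ℝ, 0 < K → |P| / K < ε → ∀ j : Fin N,
      (∃! p : ℝ × ℝ, IsSaddleAngles P K m s j p.1 p.2) ∧
      ∀ a b, IsSaddleAngles P K m s j a b →
        |a - hatAngle N m s| ≤ η ∧ |b - hatAngle N m s| ≤ η := by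
  have h4 : (4 : ℝ) ≤ N := by
    obtain ⟨k, rfl⟩ := hN
    exact_mod_cast (by omega : 4 ≤ k + k)
  obtain ⟨ε, hε, hex⟩ := exists_balanced_angles (A := (N : ℝ) - 4) (B := N) (by linarith)
    (by linarith) hη hl.le hu.le
  refine ⟨ε, hε, fun P K hK hP j => ?_⟩
  have hp : |P / K| < ε := by rwa [abs_div, abs_of_pos hK]
  have huniq : ∀ a b a' b', IsSaddleAngles P K m s j a b → IsSaddleAngles P K m s j a' b' →
      a = a' ∧ b = b' := by
    intro a b a' b' h h'
    rw [isSaddleAngles_iff hN hN2] at h h'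
    obtain ⟨h1, h2, h3, h4'⟩ := h
    obtain ⟨h1', h2', h3', h4''⟩ := h'
    have e := h4'.trans h4''.symm
    split_ifs at e
    · exact balanced_angles_unique (by linarith) (by linarith) h1 h2 h1' h2' e
        (h3.trans h3'.symm)
    · exact (balanced_angles_unique (A := (N : ℝ) - 4) (B := N) (by linarith) (by linarith)
        h2 h1 h2' h1' (by linarith) (by linarith)).symm
  have hexist : ∃ a b, IsSaddleAngles P K m s j a b ∧
      |a - hatAngle N m s| ≤ η ∧ |b - hatAngle N m s| ≤ η := by
    by_cases hj : Even (j : ℕ)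
    · obtain ⟨a, b, h1, h2, h3, h5⟩ := hex (P / K) hp
      have h1' := abs_le.1 h1
      have h2' := abs_le.1 h2
      refine ⟨a, b, (isSaddleAngles_iff hN hN2).2 ⟨⟨by linarith, by linarith⟩,
        ⟨by linarith, by linarith⟩, h5, ?_⟩, h1, h2⟩
      rw [if_pos hj, h3]; ring
    · obtain ⟨a, b, h1, h2, h3, h5⟩ := hex (-(P / K)) (by rwa [abs_neg])
      have h1' := abs_le.1 h1
      have h2' := abs_le.1 h2
      refine ⟨b, a, (isSaddleAngles_iff hN hN2).2 ⟨⟨by linarith, by linarith⟩,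
        ⟨by linarith, by linarith⟩, by linarith, ?_⟩, h2, h1⟩
      rw [if_neg hj]; linarith
  obtain ⟨a, b, hab, hcl⟩ := hexist
  refine ⟨⟨(a, b), hab, ?_⟩, ?_⟩
  · rintro ⟨a', b'⟩ h'
    obtain ⟨e1, e2⟩ := huniq _ _ _ _ h' hab
    exact Prod.ext e1 e2
  · intro a' b' h'
    obtain ⟨e1, e2⟩ := huniq _ _ _ _ h' hab
    rw [e1, e2]
    exact hcl

end Angles

/-! ### The capped region: invariance, decrease of the exceptional angle, equilibria. -/

section Dynamics

/-- Between x and π - x the sine is at least sin x, and it is 1-Lipschitz; q measures how far y may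
lie outside. -/
theorem sin_sub_le_sin {x y q : ℝ} (hx : x ∈ Icc (-(π / 2)) (π / 2)) (hq : 0 ≤ q)
    (hl : x - q ≤ y) (hu : y ≤ π - x + q) : sin x - q ≤ sin y := by
  rcases le_total y x with h | h
  · have := (abs_le.1 (abs_sin_sub_sin_le y x)).1
    rw [abs_of_nonpos (by linarith : y - x ≤ 0)] at this
    linarith
  rcases le_total (π - x) y with h' | h'
  · have := (abs_le.1 (abs_sin_sub_sin_le y (π - x))).1
    rw [abs_of_nonneg (by linarith : 0 ≤ y - (π - x)), sin_pi_sub] at this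
    linarith
  rcases le_total y (π / 2) with h2 | h2
  · have := strictMonoOn_sin.monotoneOn hx ⟨by linarith [hx.1], h2⟩ h
    linarith
  · have := strictMonoOn_sin.monotoneOn hx (b := π - y) ⟨by linarith [hx.1], by linarith⟩
      (by linarith)
    rw [sin_pi_sub] at this
    linarith

/-- The sine is monotone from -π/2 to x and 1-Lipschitz beyond; e and q are the allowed overshoots
at the upper and the lower end. -/
theorem sin_le_sin_add {x y q e : ℝ} (hx : x ∈ Icc (-(π / 2)) (π / 2)) (hq : 0 ≤ q) (he : 0 ≤ e)
    (hl : -(π / 2) - q ≤ y) (hu : y ≤ x + e) : sin y ≤ sin x + e + q := by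
  rcases le_total x y with h | h
  · have := (abs_le.1 (abs_sin_sub_sin_le y x)).2
    rw [abs_of_nonneg (by linarith : 0 ≤ y - x)] at this
    linarith
  rcases le_total y (-(π / 2)) with h' | h'
  · have := (abs_le.1 (abs_sin_sub_sin_le y (-(π / 2)))).2
    rw [abs_of_nonpos (by linarith : y - -(π / 2) ≤ 0), sin_neg, sin_pi_div_two] at this
    linarith [neg_one_le_sin x]
  · have := strictMonoOn_sin.monotoneOn ⟨h', by linarith [hx.2]⟩ hx h
    linarith

variable {N : ℕ} [NeZero N]

theorem hasDerivAt_phaseDiff {P K : ℝ} (m : ℤ) {γ : ℝ → Config N} {t : ℝ}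
    (h : HasDerivAt γ (gradField P K (γ t)) t) (i : Fin N) :
    HasDerivAt (fun t => phaseDiff m (γ t) i)
      (force P K (phaseDiff m (γ t)) i - force P K (phaseDiff m (γ t)) (i - 1)) t := by
  have hp : ∀ i : Fin N, HasDerivAt (fun t => γ t i) (gradField P K (γ t) i) t := fun i =>
    (EuclideanSpace.proj i : Config N →L[ℝ] ℝ).hasFDerivAt.comp_hasDerivAt t h
  have := ((hp i).fun_sub (hp (i - 1))).add_const (if i = 0 then 2 * π * m else 0)
  rw [gradField_apply P K m, gradField_apply P K m] at this
  exact this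

/-- One-sided constraints on phase differences propagate along a solution. -/
theorem constraints_propagate {P K : ℝ} {m : ℤ} {S : Set (Fin N → ℝ)} {ι : Type*} [Fintype ι]
    {C : ℝ} (hC : 0 ≤ C) (idx : ι → Fin N) (sg cn : ι → ℝ)
    (hb : ∀ θ ∈ S, ∀ c, 0 < sg c * θ (idx c) - cn c →
      sg c * (force P K θ (idx c) - force P K θ (idx c - 1))
        ≤ C * ∑ d, max (sg d * θ (idx d) - cn d) 0)
    {T : ℝ} {γ : ℝ → Config N} (hγ : IsIntegralCurveOn γ (fun _ => gradField P K) (Icc 0 T))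
    (hS : ∀ t ∈ Icc 0 T, phaseDiff m (γ t) ∈ S)
    (h0 : ∀ c, sg c * phaseDiff m (γ 0) (idx c) - cn c ≤ 0) :
    ∀ c, ∀ t ∈ Icc 0 T, sg c * phaseDiff m (γ t) (idx c) - cn c ≤ 0 := by
  have hd : ∀ t ∈ Ioo 0 T, HasDerivAt γ (gradField P K (γ t)) t := fun t ht =>
    (hγ t (Ioo_subset_Icc_self ht)).hasDerivAt (Icc_mem_nhds ht.1 ht.2)
  have hcont : ContinuousOn (fun t => phaseDiff m (γ t)) (Icc 0 T) :=
    (continuous_phaseDiff m).comp_continuousOn hγ.continuousOn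
  refine quasi_invariance
    (v := fun c t => sg c * phaseDiff m (γ t) (idx c) - cn c)
    (v' := fun c t => sg c * (force P K (phaseDiff m (γ t)) (idx c)
      - force P K (phaseDiff m (γ t)) (idx c - 1))) hC (fun c => ?_) (fun c t ht => ?_) h0
    fun c t ht hpos => hb _ (hS t (Ioo_subset_Icc_self ht)) c hpos
  · exact (continuousOn_const.mul (continuousOn_pi.1 hcont (idx c))).sub continuousOn_const
  · exact ((hasDerivAt_phaseDiff m (hd t ht) (idx c)).const_mul _).sub_const _

theorem IsTrajectory.comp_add {P K : ℝ} {γ : ℝ → Config N} (h : IsTrajectory P K γ) (c : ℝ) :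
    IsTrajectory P K fun t => γ (t + c) :=
  IsIntegralCurve.comp_add h c

theorem ForwardInvariant.mem {P K : ℝ} {m : ℤ} {S : Set (Fin N → ℝ)}
    (hS : ForwardInvariant P K m S) {γ : ℝ → Config N} (h : IsTrajectory P K γ) {t₀ t : ℝ}
    (h0 : phaseDiff m (γ t₀) ∈ S) (ht : t₀ ≤ t) : phaseDiff m (γ t) ∈ S := by
  have := hS (t - t₀) (fun t => γ (t + t₀)) (by linarith)
    ((h.comp_add t₀).isIntegralCurveOn _) (by simpa using h0) (t - t₀) ⟨by linarith, le_rfl⟩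
  simpa using this

theorem force_sub_force (hN : Even N) {P K a b : ℝ} (hK : 0 < K)
    (hab : sin a - sin b = P / K) (θ : Fin N → ℝ) (i : Fin N) :
    force P K θ i - force P K θ (i - 1) =
      K * ((sin (θ (i + 1)) - sin (alternating a b (i + 1)))
        + (sin (θ (i - 1)) - sin (alternating a b (i - 1)))
        - 2 * (sin (θ i) - sin (alternating a b i))) := by
  rw [force_eq_of_balance hN hK hab, force_eq_of_balance hN hK hab, sub_add_cancel]
  ring

/-- The data of a saddle with `s = 1` whose angles are `η`-close to `h`, with `η` small. -/
structure NearSaddle (m : ℤ) (P K h η a b : ℝ) (j : Fin N) : Prop where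
  even : Even N
  two_lt : 2 < N
  K_pos : 0 < K
  abs_lt : |h| < π / 2
  η_pos : 0 < η
  η_cos : 16 * η ≤ cos h
  η_sin : 10 * η ≤ 1 - sin (π / 4 + h / 2)
  close_a : |a - h| ≤ η
  close_b : |b - h| ≤ η
  balance : sin a - sin b = P / K
  sum_eq : ∑ i, saddle 1 a b j i = 2 * π * m

/-- The part of the simplex `{θ_i ≥ τ_i}`, `τ = (a, b, …, a, b)`, in which only the `j`-th line angle
may exceed `π/2`. -/
def cappedRegion (m : ℤ) (a b : ℝ) (j : Fin N) : Set (Fin N → ℝ) :=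
  {θ | (∀ i, alternating a b i ≤ θ i) ∧ (∀ k, k ≠ j → θ k ≤ π / 2) ∧ ∑ i, θ i = 2 * π * m}

theorem le_add_sum_sub {τ θ : Fin N → ℝ} (h : ∀ i, τ i ≤ θ i) (i : Fin N) :
    θ i - τ i ≤ ∑ k, (θ k - τ k) :=
  Finset.single_le_sum (f := fun k => θ k - τ k) (fun k _ => sub_nonneg.2 (h k)) (Finset.mem_univ i)

theorem three_le_sum {f : Fin N → ℝ} (hN : 2 < N) (hf : ∀ i, 0 ≤ f i) (k : Fin N) :
    f (k - 1) + f k + f (k + 1) ≤ ∑ i, f i := by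
  have h1 := sub_one_ne_self (by omega : 1 < N) k
  have h2 := add_one_ne_self (by omega : 1 < N) k
  have h3 := sub_one_ne_add_one hN k
  have := Finset.sum_le_sum_of_subset_of_nonneg (Finset.subset_univ {k - 1, k, k + 1})
    fun i _ _ => hf i
  rw [Finset.sum_insert (by simp [h1, h3]), Finset.sum_insert (by simp [h2.symm]),
    Finset.sum_singleton] at this
  linarith

namespace NearSaddle

variable {m : ℤ} {P K h η a b : ℝ} {j : Fin N}

theorem cos_le (H : NearSaddle m P K h η a b j) : cos h ≤ π / 2 - |h| := by
  rw [← cos_abs, ← sin_pi_div_two_sub]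
  exact sin_le (by linarith [H.abs_lt])

theorem h_bounds (H : NearSaddle m P K h η a b j) :
    -(π / 2) < h - 15 * η ∧ h + 15 * η < π / 2 := by
  have h1 := H.cos_le
  have h2 := H.η_cos
  have h3 := H.η_pos
  constructor <;> linarith [neg_abs_le h, le_abs_self h]

theorem τ_close (H : NearSaddle m P K h η a b j) (i : Fin N) :
    h - η ≤ alternating a b i ∧ alternating a b i ≤ h + η := by
  have h1 := abs_le.1 H.close_a
  have h2 := abs_le.1 H.close_b
  unfold alternating
  split_ifs <;> constructor <;> linarith

theorem τ_mem (H : NearSaddle m P K h η a b j) (i : Fin N) :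
    alternating a b i ∈ Icc (-(π / 2)) (π / 2) := by
  have h1 := H.τ_close i
  have h2 := H.h_bounds
  have h3 := H.η_pos
  constructor <;> linarith

/-- This is the budget: the total excess over τ is the same for all θ with sum 2πm, and the saddle
spends all of it at place j. -/
theorem sum_sub (H : NearSaddle m P K h η a b j) {θ : Fin N → ℝ} (hθ : ∑ i, θ i = 2 * π * m) :
    ∑ i, (θ i - alternating a b i) = π - 2 * alternating a b j := by
  have h1 := H.sum_eq
  rw [sum_saddle H.even] at h1
  rw [Finset.sum_sub_distrib, hθ, sum_alternating H.even]
  linarith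

theorem isCompact_cappedRegion (H : NearSaddle m P K h η a b j) :
    IsCompact (cappedRegion m a b j) := by
  refine (isCompact_Icc (a := fun i => alternating a b i)
    (b := fun i => alternating a b i + (π - 2 * alternating a b j))).of_isClosed_subset ?_ ?_
  · unfold cappedRegion
    simp only [ofPred_and, ofPred_forall]
    refine (isClosed_iInter fun i => isClosed_le continuous_const (continuous_apply i)).inter
      ((isClosed_iInter fun k => isClosed_iInter fun _ =>
        isClosed_le (continuous_apply k) continuous_const).inter
      (isClosed_eq (by fun_prop) continuous_const))
  · intro θ hθ
    refine ⟨hθ.1, fun i => ?_⟩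
    have := le_add_sum_sub hθ.1 i
    rw [H.sum_sub hθ.2.2] at this
    linarith

/-- Angles slightly outside the capped region. -/
theorem sin_lower (H : NearSaddle m P K h η a b j) {θ : Fin N → ℝ} (hθ : ∑ i, θ i = 2 * π * m)
    {Q : ℝ} (hn : ∑ i, max (alternating a b i - θ i) 0 ≤ Q)
    (hq : ∀ k, k ≠ j → θ k ≤ π / 2 + Q) (i : Fin N) :
    sin (alternating a b i) - Q ≤ sin (θ i) := by
  have hsum := H.sum_sub hθ
  have hnn : ∀ i, 0 ≤ max (alternating a b i - θ i) 0 := fun i => le_max_right _ _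
  have hQ : 0 ≤ Q := (Finset.sum_nonneg fun i _ => hnn i).trans hn
  have hni : max (alternating a b i - θ i) 0 ≤ Q :=
    (Finset.single_le_sum (f := fun i => max (alternating a b i - θ i) 0) (fun i _ => hnn i)
      (Finset.mem_univ i)).trans hn
  refine sin_sub_le_sin (H.τ_mem i) hQ (by linarith [le_max_left (alternating a b i - θ i) 0]) ?_
  -- The j-th angle is bounded above by the budget, up to the total deficit; every other angle is
  -- bounded by its cap.
  by_cases hij : i = j
  · have h1 : ∀ k, 0 ≤ (θ k - alternating a b k) + max (alternating a b k - θ k) 0 := fun k => by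
      linarith [le_max_left (alternating a b k - θ k) 0]
    have h2 := Finset.single_le_sum (f := fun k => (θ k - alternating a b k)
      + max (alternating a b k - θ k) 0) (fun k _ => h1 k) (Finset.mem_univ i)
    rw [Finset.sum_add_distrib, hsum, ← hij] at h2
    have h3 := hnn i
    linarith
  · linarith [hq i hij, (H.τ_mem i).2]

/-- When θ_k is near π/2 the budget bounds the sum of its neighbours by about π/2 + h, so the
smaller one is at most about π/4 + h/2. The gap 1 - sin (π/4 + h/2) ≥ 10 η pays for the errors and
leaves 4 η, needed later for the variation of sin τ. -/
theorem sin_sum_upper (H : NearSaddle m P K h η a b j) {θ : Fin N → ℝ}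
    (hθ : ∑ i, θ i = 2 * π * m) {Q : ℝ} (hn : ∑ i, max (alternating a b i - θ i) 0 ≤ Q)
    {k : Fin N} (hk : π / 2 < θ k) (hkQ : θ k ≤ π / 2 + Q) :
    sin (θ (k + 1)) + sin (θ (k - 1)) - 2 * sin (θ k) ≤ 4 * Q - 4 * η := by
  have hsum := H.sum_sub hθ
  have hnn : ∀ i, 0 ≤ max (alternating a b i - θ i) 0 := fun i => le_max_right _ _
  have hQ : 0 ≤ Q := (Finset.sum_nonneg fun i _ => hnn i).trans hn
  have hni : ∀ i, max (alternating a b i - θ i) 0 ≤ Q := fun i =>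
    (Finset.single_le_sum (f := fun i => max (alternating a b i - θ i) 0) (fun i _ => hnn i)
      (Finset.mem_univ i)).trans hn
  have h1 : ∀ k, 0 ≤ (θ k - alternating a b k) + max (alternating a b k - θ k) 0 := fun k => by
    linarith [le_max_left (alternating a b k - θ k) 0]
  have h2 := three_le_sum H.two_lt h1 k
  rw [Finset.sum_add_distrib, hsum] at h2
  have hτ1 := H.τ_close (k - 1)
  have hτ2 := H.τ_close k
  have hτ3 := H.τ_close (k + 1)
  have hτj := H.τ_close j
  have hbd := H.h_bounds
  have hη := H.η_pos
  have hηs := H.η_sin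
  have hs : θ (k - 1) + θ (k + 1) ≤ π / 2 + h + 5 * η + Q := by
    linarith [hnn (k - 1), hnn k, hnn (k + 1)]
  have hl1 : h - η - Q ≤ θ (k - 1) := by
    linarith [le_max_left (alternating a b (k - 1) - θ (k - 1)) 0, hni (k - 1)]
  have hl2 : h - η - Q ≤ θ (k + 1) := by
    linarith [le_max_left (alternating a b (k + 1) - θ (k + 1)) 0, hni (k + 1)]
  have hsk : 1 - Q ≤ sin (θ k) := by
    have := sin_sub_le_sin (x := π / 2) (y := θ k) (q := Q) ⟨by linarith [pi_pos], le_rfl⟩ hQ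
      (by linarith) (by linarith)
    rwa [sin_pi_div_two] at this
  have key : ∀ x y : ℝ, x ≤ y → x + y ≤ π / 2 + h + 5 * η + Q → h - η - Q ≤ x →
      sin y + sin x ≤ 1 + (sin (π / 4 + h / 2) + (5 * η / 2 + Q / 2) + Q) := by
    intro x y hxy hs hl
    have hm := sin_le_sin_add (x := π / 4 + h / 2) (y := x) (q := Q) (e := 5 * η / 2 + Q / 2)
      ⟨by linarith, by linarith⟩ hQ (by linarith) (by linarith) (by linarith)
    linarith [sin_le_one y]
  rcases le_total (θ (k - 1)) (θ (k + 1)) with hc | hc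
  · have := key _ _ hc hs hl1
    linarith
  · have := key _ _ hc (by linarith) hl2
    linarith

theorem abs_sin_τ_sub (H : NearSaddle m P K h η a b j) (i k : Fin N) :
    sin (alternating a b i) - sin (alternating a b k) ≤ 2 * η := by
  have h1 := H.τ_close i
  have h2 := H.τ_close k
  refine (le_abs_self _).trans ((abs_sin_sub_sin_le _ _).trans ?_)
  rw [abs_le]
  constructor <;> linarith

/-- Both kinds of constraint are checked slightly outside the region, with Q the total violation:
each wrong-way velocity is at most 4 K Q, which is what Grönwall requires. A pointwise check on the
boundary would not be enough for this argument. -/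
theorem forwardInvariant_cappedRegion (H : NearSaddle m P K h η a b j) :
    ForwardInvariant P K m (cappedRegion m a b j) := by
  intro T γ hT hγ h0 t ht
  -- Left summands encode the lower bounds -θ_i + τ_i ≤ 0, right summands the caps θ_k - π/2 ≤ 0.
  let idx : Fin N ⊕ {k : Fin N // k ≠ j} → Fin N := Sum.elim id Subtype.val
  let sg : Fin N ⊕ {k : Fin N // k ≠ j} → ℝ := Sum.elim (fun _ => -1) (fun _ => 1)
  let cn : Fin N ⊕ {k : Fin N // k ≠ j} → ℝ :=
    Sum.elim (fun i => -alternating a b i) (fun _ => π / 2)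
  have hK := H.K_pos
  have key := constraints_propagate (P := P) (K := K) (m := m) (S := {θ | ∑ i, θ i = 2 * π * m})
    (C := 4 * K) (by linarith) idx sg cn ?_ hγ (fun t _ => sum_phaseDiff m (γ t)) ?_
  · refine ⟨fun i => ?_, fun k hk => ?_, sum_phaseDiff m (γ t)⟩
    · have := key (Sum.inl i) t ht
      simp only [idx, sg, cn, Sum.elim_inl, id] at this
      linarith
    · have := key (Sum.inr ⟨k, hk⟩) t ht
      simp only [idx, sg, cn, Sum.elim_inr] at this
      linarith
  · intro θ hθ c hc
    change ∑ i, θ i = 2 * π * m at hθ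
    set Q := ∑ d, max (sg d * θ (idx d) - cn d) 0 with hQ
    have hQ' : Q = ∑ i, max (alternating a b i - θ i) 0
        + ∑ k : {k : Fin N // k ≠ j}, max (θ k - π / 2) 0 := by
      rw [hQ, Fintype.sum_sum_type]
      congr 1
      · refine Finset.sum_congr rfl fun i _ => ?_
        simp only [idx, sg, cn, Sum.elim_inl, id]
        congr 1
        ring
      · refine Finset.sum_congr rfl fun i _ => ?_
        simp only [idx, sg, cn, Sum.elim_inr]
        congr 1
        ring
    have hn0 : 0 ≤ ∑ i, max (alternating a b i - θ i) 0 :=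
      Finset.sum_nonneg fun i _ => le_max_right _ _
    have hq0 : 0 ≤ ∑ k : {k : Fin N // k ≠ j}, max (θ k - π / 2) 0 :=
      Finset.sum_nonneg fun i _ => le_max_right _ _
    have hn : ∑ i, max (alternating a b i - θ i) 0 ≤ Q := by linarith
    have hq : ∀ k, k ≠ j → θ k ≤ π / 2 + Q := by
      intro k hk
      have := Finset.single_le_sum (f := fun k : {k : Fin N // k ≠ j} => max (θ k - π / 2) 0)
        (fun i _ => le_max_right _ _) (Finset.mem_univ ⟨k, hk⟩)
      simp only at this
      linarith [le_max_left (θ k - π / 2) 0]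
    have hlow := H.sin_lower hθ hn hq
    rw [force_sub_force H.even hK H.balance]
    rcases c with i | ⟨k, hk⟩
    · simp only [idx, sg, cn, Sum.elim_inl, id] at hc ⊢
      have hup : sin (θ i) ≤ sin (alternating a b i) + Q := by
        have h1 := (abs_le.1 (abs_sin_sub_sin_le (θ i) (alternating a b i))).2
        rw [abs_of_nonpos (by linarith)] at h1
        have h2 := Finset.single_le_sum (f := fun i => max (alternating a b i - θ i) 0)
          (fun i _ => le_max_right _ _) (Finset.mem_univ i)
        linarith [le_max_left (alternating a b i - θ i) 0]
      have e := mul_le_mul_of_nonneg_left (by linarith [hlow (i + 1), hlow (i - 1)] :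
        -((sin (θ (i + 1)) - sin (alternating a b (i + 1)))
        + (sin (θ (i - 1)) - sin (alternating a b (i - 1)))
        - 2 * (sin (θ i) - sin (alternating a b i))) ≤ 4 * Q) hK.le
      linarith
    · simp only [idx, sg, cn, Sum.elim_inr] at hc ⊢
      have h1 := H.sin_sum_upper hθ hn (k := k) (by linarith) (hq k hk)
      have h2 := H.abs_sin_τ_sub k (k + 1)
      have h3 := H.abs_sin_τ_sub k (k - 1)
      have e := mul_le_mul_of_nonneg_left (by linarith :
        ((sin (θ (k + 1)) - sin (alternating a b (k + 1)))
        + (sin (θ (k - 1)) - sin (alternating a b (k - 1)))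
        - 2 * (sin (θ k) - sin (alternating a b k))) ≤ 4 * Q) hK.le
      linarith
  · rintro (i | ⟨k, hk⟩)
    · simp only [idx, sg, cn, Sum.elim_inl, id]
      linarith [h0.1 i]
    · simp only [idx, sg, cn, Sum.elim_inr]
      linarith [h0.2.1 k hk]

/-- Close to the saddle, the exceptional angle decreases. -/
theorem force_sub_nonpos (H : NearSaddle m P K h η a b j) {θ : Fin N → ℝ}
    (hθ : θ ∈ cappedRegion m a b j) (hj : π - alternating a b j - 2 * η ≤ θ j) :
    force P K θ j - force P K θ (j - 1) ≤ 0 := by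
  rw [force_sub_force H.even H.K_pos H.balance]
  obtain ⟨h1, h2, h3⟩ := hθ
  have hη := H.η_pos
  set u := fun i => θ i - alternating a b i with hu
  have hu0 : ∀ i, 0 ≤ u i := fun i => sub_nonneg.2 (h1 i)
  have hsum := three_le_sum H.two_lt hu0 j
  rw [H.sum_sub h3] at hsum
  -- The distance w of θ_j from its saddle value bounds the joint excess of the two neighbours.
  -- Their sines gain at most (cos h + 3η) w together, while twice the gain at j is at least 2 (cos
  -- h - 3η) w; this is larger since 16 η ≤ cos h.
  set w := π - alternating a b j - θ j with hw
  have hw0 : u (j - 1) + u (j + 1) ≤ w := by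
    simp only [hu] at hsum ⊢
    linarith
  have hw2 : w ≤ 2 * η := by linarith
  have hcos : ∀ x, |x - h| ≤ 3 * η → cos h - 3 * η ≤ cos x ∧ cos x ≤ cos h + 3 * η := by
    intro x hx
    have := abs_le.1 ((abs_cos_sub_cos_le x h).trans hx)
    constructor <;> linarith
  have hc := H.η_cos
  have hnb : ∀ i, u i ≤ 2 * η → sin (θ i) - sin (alternating a b i) ≤ (cos h + 3 * η) * u i := by
    intro i hi
    have hτ := H.τ_close i
    refine (convex_Icc (alternating a b i) (θ i)).image_sub_le_mul_sub_of_deriv_le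
      continuous_sin.continuousOn differentiable_sin.differentiableOn ?_ _
      (left_mem_Icc.2 (h1 i)) _ (right_mem_Icc.2 (h1 i)) (h1 i)
    intro x hx
    rw [interior_Icc] at hx
    rw [Real.deriv_sin]
    refine (hcos x ?_).2
    simp only [hu] at hi
    rw [abs_le]
    constructor <;> linarith [hx.1, hx.2]
  have hself : (cos h - 3 * η) * w ≤ sin (θ j) - sin (alternating a b j) := by
    have hτ := H.τ_close j
    have hle : alternating a b j ≤ alternating a b j + w := by linarith [hu0 (j - 1), hu0 (j + 1)]
    have := (convex_Icc (alternating a b j)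
      (alternating a b j + w)).mul_sub_le_image_sub_of_le_deriv
      continuous_sin.continuousOn differentiable_sin.differentiableOn (C := cos h - 3 * η) ?_ _
      (left_mem_Icc.2 hle) _ (right_mem_Icc.2 hle) hle
    · rw [show alternating a b j + w = π - θ j by rw [hw]; ring, sin_pi_sub] at this
      rw [show w = π - θ j - alternating a b j by rw [hw]; ring]
      exact this
    · intro x hx
      rw [interior_Icc] at hx
      rw [Real.deriv_sin]
      refine (hcos x ?_).1
      rw [abs_le]
      constructor <;> linarith [hx.1, hx.2]
  have e1 := hnb (j - 1) (by linarith [hu0 (j + 1)])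
  have e2 := hnb (j + 1) (by linarith [hu0 (j - 1)])
  refine mul_nonpos_of_nonneg_of_nonpos H.K_pos.le ?_
  have hw00 : 0 ≤ w := by linarith [hu0 (j - 1), hu0 (j + 1)]
  have e3 : (cos h + 3 * η) * (u (j - 1) + u (j + 1)) ≤ (cos h + 3 * η) * w :=
    mul_le_mul_of_nonneg_left hw0 (by linarith)
  have e4 : (cos h + 3 * η) * w ≤ 2 * (cos h - 3 * η) * w :=
    mul_le_mul_of_nonneg_right (by linarith) hw00
  linarith

/-- Within 2η of its saddle value θ_j cannot increase, so each face at distance r ≤ 2η is crossed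
only downwards. -/
theorem angle_le_of_le (H : NearSaddle m P K h η a b j) {γ : ℝ → Config N}
    (hγ : IsTrajectory P K γ) {r : ℝ} (hr : r ≤ 2 * η) {t₀ t : ℝ}
    (hR : phaseDiff m (γ t₀) ∈ cappedRegion m a b j)
    (h0 : phaseDiff m (γ t₀) j ≤ π - alternating a b j - r) (ht : t₀ ≤ t) :
    phaseDiff m (γ t) j ≤ π - alternating a b j - r := by
  have key := constraints_propagate (P := P) (K := K) (m := m) (S := cappedRegion m a b j)
    (C := 0) le_rfl (fun _ : Unit => j) (fun _ => 1) (fun _ => π - alternating a b j - r) ?_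
    (γ := fun t => γ (t + t₀)) (T := t - t₀) ((hγ.comp_add t₀).isIntegralCurveOn _) ?_ ?_
    () (t - t₀) ⟨by linarith, le_rfl⟩
  · simp only [one_mul, sub_add_cancel] at key
    linarith
  · intro θ hθ _ hpos
    simp only [one_mul, zero_mul] at hpos ⊢
    exact H.force_sub_nonpos hθ (by linarith)
  · intro s hs
    exact H.forwardInvariant_cappedRegion.mem hγ hR (by linarith [hs.1])
  · intro _
    simp only [one_mul, zero_add]
    linarith

/-- The equilibria in the capped region. -/
theorem eq_of_force_eq_zero (H : NearSaddle m P K h η a b j) {θ : Fin N → ℝ}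
    (hφ : |2 * π * m / N| < π / 2)
    (hθ : θ ∈ cappedRegion m a b j) (hf : force P K θ = 0) :
    (θ j ≤ π / 2 ∧ θ = syncState N m P K) ∨ θ = saddle 1 a b j := by
  obtain ⟨h1, h2, h3⟩ := hθ
  have hK := H.K_pos
  obtain ⟨f, hfc⟩ : ∃ f, ∀ i, sin (θ i) = sin (alternating a b i) + f := by
    refine ⟨sin (θ 0) - sin (alternating a b (0 : Fin N)), fun i => ?_⟩
    have := eq_const_of_add_one (f := fun i : Fin N => sin (θ i) - sin (alternating a b i)) (fun i => ?_) i 0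
    · linarith
    · have h := congrFun hf i
      rw [force_eq_of_balance H.even hK H.balance, Pi.zero_apply, mul_eq_zero] at h
      have := h.resolve_left hK.ne'
      linarith
  have hmem : ∀ k, k ≠ j → θ k ∈ Icc (-(π / 2)) (π / 2) := fun k hk =>
    ⟨(H.τ_mem k).1.trans (h1 k), h2 k hk⟩
  have harc : ∀ k, θ k ∈ Icc (-(π / 2)) (π / 2) →
      θ k = alternating (arcsin (sin a + f)) (arcsin (sin b + f)) k := by
    intro k hk
    rw [← arcsin_sin hk.1 hk.2, hfc]
    exact comp_alternating (fun x => arcsin (sin x + f)) a b k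
  rcases le_or_gt (θ j) (π / 2) with hj | hj
  · left
    refine ⟨hj, ?_⟩
    set A := arcsin (sin a + f) with hA
    set B := arcsin (sin b + f) with hB
    have hall : ∀ k, θ k = alternating A B k := fun k => by
      by_cases hk : k = j
      · subst hk; exact harc k ⟨(H.τ_mem k).1.trans (h1 k), hj⟩
      · exact harc k (hmem k hk)
    have hsumAB : (N : ℝ) * ((A + B) / 2) = 2 * π * m := by
      rw [← sum_alternating H.even, ← h3]
      exact Finset.sum_congr rfl fun k _ => (hall k).symm
    have hN0 : (N : ℝ) ≠ 0 := by have := H.two_lt; positivity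
    have hmid : (A + B) / 2 = 2 * π * m / N := by
      rw [eq_div_iff hN0, ← hsumAB]; ring
    have hsinAB : sin A - sin B = P / K := by
      rw [← H.balance]
      have e0 := hfc 0
      have e1 := hfc (0 + 1)
      rw [hall, alternating] at e0 e1
      rw [if_pos (by simp)] at e0
      rw [if_neg (by rw [even_val_add_one H.even]; simp)] at e1
      rw [alternating_add_one H.even] at e1
      simp only [alternating, Fin.val_zero, Even.zero, if_true] at e0 e1
      linarith
    have hc : 0 < cos (2 * π * m / N) :=
      cos_pos_of_mem_Ioo ⟨(_root_.abs_lt.1 hφ).1, (_root_.abs_lt.1 hφ).2⟩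
    have hdiff : arcsin (P / (2 * K * cos (2 * π * m / N))) = (A - B) / 2 := by
      have e : P / (2 * K * cos (2 * π * m / N)) = sin ((A - B) / 2) := by
        rw [sin_sub_sin, hmid] at hsinAB
        rw [div_eq_iff (by positivity)]
        rw [eq_div_iff hK.ne'] at hsinAB
        linarith
      rw [e]
      apply arcsin_sin <;>
      linarith [neg_pi_div_two_le_arcsin (sin a + f), arcsin_le_pi_div_two (sin a + f),
        neg_pi_div_two_le_arcsin (sin b + f), arcsin_le_pi_div_two (sin b + f)]
    funext k
    rw [hall, syncState, hdiff, ← hmid]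
    congr 1 <;> ring
  · right
    have hj1 := add_one_ne_self (by have := H.two_lt; omega : 1 < N) j
    have hj2 := add_one_add_one_ne_self H.two_lt j
    -- Places j and j + 2 have the same parity and equal sines, on opposite sides of π/2. Their
    -- excesses add up to π - 2 τ_j, the entire budget, which leaves nothing for j + 1 and forces f
    -- = 0.
    have hjj : θ (j + 1 + 1) = π - θ j := by
      have e1 := harc _ (hmem _ hj2)
      rw [alternating_add_one H.even, alternating_add_one H.even] at e1
      rw [e1, ← comp_alternating (fun x => arcsin (sin x + f)) a b j, ← hfc, ← sin_pi_sub,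
        arcsin_sin]
      · have := le_add_sum_sub h1 j
        rw [H.sum_sub h3] at this
        linarith [(H.τ_mem j).1]
      · linarith
    set u := fun i => θ i - alternating a b i with hu
    have hu0 : ∀ i, 0 ≤ u i := fun i => sub_nonneg.2 (h1 i)
    have hs3 := three_le_sum H.two_lt hu0 (j + 1)
    rw [H.sum_sub h3, add_sub_cancel_right] at hs3
    have hz : θ (j + 1) = alternating a b (j + 1) := by
      refine le_antisymm ?_ (h1 _)
      simp only [hu, hjj] at hs3
      rw [alternating_add_one H.even _ _ (j + 1), alternating_add_one H.even a b j,
        alternating_add_one H.even b a j] at hs3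
      rw [alternating_add_one H.even _ _ j]
      linarith
    have hf0 : f = 0 := by
      have := hfc (j + 1)
      rw [hz] at this
      linarith
    have hne : ∀ k, k ≠ j → θ k = alternating a b k := fun k hk => by
      apply injOn_sin (hmem k hk) (H.τ_mem k)
      rw [hfc, hf0, add_zero]
    funext k
    by_cases hk : k = j
    · subst hk
      rw [saddle_same]
      have e := H.sum_sub h3
      rw [Finset.sum_eq_single k (fun i _ hi => by rw [hne i hi, sub_self]) (by simp)] at e
      linarith
    · rw [saddle_of_ne _ _ _ hk, hne k hk]

end NearSaddle

end Dynamics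

/-! ### Construction of the trajectory from the saddle to the synchronous state. -/

section Connection

variable {N : ℕ} [NeZero N]

/-- The phase differences (without winding) together with the phase of the first node. -/
noncomputable def diffMap (N : ℕ) [NeZero N] : Config N →ₗ[ℝ] (Fin N → ℝ) × ℝ where
  toFun δ := (fun i => δ i - δ (i - 1), δ 0)
  map_add' x y := by ext <;> simp; ring
  map_smul' c x := by ext <;> simp; ring

/-- Phase differences fix a configuration up to a common shift, and the phase of one node fixes the
shift. Compactness and convergence thus transfer from phase differences to normalised
configurations. -/
theorem isClosedEmbedding_diffMap : IsClosedEmbedding (diffMap N) := by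
  refine LinearMap.isClosedEmbedding_of_injective (LinearMap.ker_eq_bot'.2 fun x hx => ?_)
  have h1 : ∀ i, x (i + 1) = x i := fun i => by
    have := congrFun (congrArg Prod.fst hx) (i + 1)
    simp only [diffMap, LinearMap.coe_mk, AddHom.coe_mk, add_sub_cancel_right, Prod.fst_zero,
      Pi.zero_apply] at this
    linarith
  have h2 : x 0 = 0 := congrArg Prod.snd hx
  ext i
  rw [eq_const_of_add_one (f := fun i => x i) h1 i 0, h2]
  rfl

theorem diffMap_fst (m : ℤ) (δ : Config N) :
    (diffMap N δ).1 = phaseDiff m δ - fun i => if i = 0 then 2 * π * m else 0 := by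
  funext i
  simp [phaseDiff, diffMap]

theorem isCompact_setOf_phaseDiff_mem (m : ℤ) {A : Set (Fin N → ℝ)} (hA : IsCompact A) :
    IsCompact {y : Config N | y 0 = 0 ∧ phaseDiff m y ∈ A} := by
  have hcomp := isClosedEmbedding_diffMap.isCompact_preimage
    ((hA.image (f := fun θ : Fin N → ℝ => θ - fun i => if i = 0 then 2 * π * m else 0)
      (by fun_prop)).prod (isCompact_singleton (x := (0 : ℝ))))
  refine hcomp.of_isClosed_subset ?_ ?_
  · exact (isClosed_eq (by fun_prop) continuous_const).inter
      (hA.isClosed.preimage (continuous_phaseDiff m))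
  · rintro y ⟨hy0, hyA⟩
    exact ⟨⟨phaseDiff m y, hyA, (diffMap_fst m y).symm⟩, hy0⟩

theorem tendsto_of_phaseDiff {ι : Type*} {l : Filter ι} {m : ℤ} {x : ι → Config N} {δ : Config N}
    (h : Tendsto (fun t => phaseDiff m (x t)) l (𝓝 (phaseDiff m δ)))
    (h0 : ∀ t, x t 0 = δ 0) : Tendsto x l (𝓝 δ) := by
  rw [isClosedEmbedding_diffMap.isInducing.tendsto_nhds_iff, Prod.tendsto_iff]
  constructor
  · simp only [Function.comp_def, diffMap_fst m]
    exact h.sub_const _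
  · have : (fun t => ((diffMap N ∘ x) t).2) = fun _ => (diffMap N δ).2 := funext h0
    rw [this]
    exact tendsto_const_nhds

theorem gradField_add_const (P K c : ℝ) (δ : Config N) :
    gradField P K (δ + WithLp.toLp 2 fun _ => c) = gradField P K δ := by
  rw [gradField_eq P K 0, gradField_eq P K 0, phaseDiff_add_const]

theorem IsTrajectory.add_const {P K : ℝ} {γ : ℝ → Config N} (h : IsTrajectory P K γ) (c : ℝ) :
    IsTrajectory P K fun t => γ t + WithLp.toLp 2 fun _ => c := by
  intro t
  have := (h t).add_const (WithLp.toLp 2 fun _ => c)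
  exact this.congr_deriv (gradField_add_const P K c (γ t)).symm

theorem isTrajectory_const {P K : ℝ} {δ : Config N} (h : IsEquilibrium P K δ) :
    IsTrajectory P K fun _ => δ :=
  isIntegralCurve_const fun _ => h

theorem abs_phaseDiff_sub_le (m : ℤ) (x y : Config N) (i : Fin N) :
    |phaseDiff m x i - phaseDiff m y i| ≤ 2 * dist x y := by
  have h : ∀ i, |x i - y i| ≤ dist x y := fun i => by
    have := PiLp.norm_apply_le (x - y) i
    rwa [← dist_eq_norm] at this
  have e : phaseDiff m x i - phaseDiff m y i = (x i - y i) - (x (i - 1) - y (i - 1)) := by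
    unfold phaseDiff; ring
  rw [e]
  refine (abs_sub _ _).trans ?_
  linarith [h i, h (i - 1)]

namespace NearSaddle

variable {m : ℤ} {P K h η a b : ℝ} {j : Fin N}

theorem isCompact_inter (H : NearSaddle m P K h η a b j) (l u : ℝ) :
    IsCompact (cappedRegion m a b j ∩ {θ | l ≤ θ j ∧ θ j ≤ u}) :=
  H.isCompact_cappedRegion.inter_right
    ((isClosed_le continuous_const (continuous_apply j)).inter
      (isClosed_le (continuous_apply j) continuous_const))

theorem le_angle_top (H : NearSaddle m P K h η a b j) {θ : Fin N → ℝ}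
    (hθ : θ ∈ cappedRegion m a b j) : θ j ≤ π - alternating a b j := by
  have := le_add_sum_sub hθ.1 j
  rw [H.sum_sub hθ.2.2] at this
  linarith

/-- Starting points close to the saddle take arbitrarily long to leave its neighbourhood. -/
theorem exists_slow_exit (H : NearSaddle m P K h η a b j) (hφ : |2 * π * m / N| < π / 2)
    {T : ℝ} (hT : 0 ≤ T) : ∃ γ, IsTrajectory P K γ ∧ γ 0 0 = 0 ∧
      phaseDiff m (γ 0) j = π - alternating a b j - η ∧
      ∀ t ∈ Icc 0 T, phaseDiff m (γ (-t)) ∈ cappedRegion m a b j ∩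
        {θ | π - alternating a b j - η ≤ θ j ∧ θ j ≤ π - alternating a b j} := by
  obtain ⟨L, M, hL, hM⟩ := exists_lipschitz_bound_gradField (N := N) P K
  obtain ⟨δ₀, hδ₀⟩ := exists_phaseDiff_eq m (saddle 1 a b j) H.sum_eq
  have hη := H.η_pos
  have hbd := H.h_bounds
  have hτj := H.τ_close j
  set τ := alternating a b j with hτ
  have h1 := sub_one_ne_self (by have := H.two_lt; omega : 1 < N) j
  have h2 := add_one_ne_self (by have := H.two_lt; omega : 1 < N) j
  -- Lowering node j by r moves r from θ_j to θ_{j+1}. The factor exp (-L T) keeps the trajectory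
  -- within η/4 of the saddle up to time T.
  set r : ℝ := η / 4 * exp (-(L * T)) with hr
  have hr0 : 0 < r := by positivity
  have hrη : r ≤ η / 4 := by
    have : exp (-(L * T)) ≤ 1 := exp_le_one_iff.2 (by have := mul_nonneg L.2 hT; linarith!)
    nlinarith
  set x : Config N := δ₀ - r • EuclideanSpace.single j (1 : ℝ) with hx
  have hdist : dist x δ₀ = r := by
    rw [dist_eq_norm, hx, sub_sub_cancel_left, norm_neg, norm_smul]
    simp [abs_of_pos hr0]
  have hpx : ∀ i, phaseDiff m x i = saddle 1 a b j i
      - (if i = j then r else 0) + (if i = j + 1 then r else 0) := by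
    intro i
    rw [← hδ₀]
    have e : ∀ k, x k = δ₀ k - if k = j then r else 0 := fun k => by
      simp [hx]
    simp only [phaseDiff, e, sub_eq_iff_eq_add (b := (1 : Fin N))]
    ring
  have hpxj : phaseDiff m x j = π - τ - r := by
    rw [hpx, saddle_same]
    simp [h2.symm, hτ]
  have hxR : phaseDiff m x ∈ cappedRegion m a b j := by
    refine ⟨fun i => ?_, fun k hk => ?_, sum_phaseDiff m x⟩
    · by_cases hi : i = j
      · subst hi; rw [hpxj]; linarith
      · rw [hpx, saddle_of_ne _ _ _ hi, if_neg hi]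
        split_ifs <;> linarith
    · rw [hpx, saddle_of_ne _ _ _ hk, if_neg hk]
      have := H.τ_close k
      split_ifs <;> linarith
  obtain ⟨γ, hγ, hγ0⟩ := exists_trajectory P K x
  have hγR : ∀ t, 0 ≤ t → phaseDiff m (γ t) ∈ cappedRegion m a b j := fun t ht =>
    H.forwardInvariant_cappedRegion.mem hγ (t₀ := 0) (by rwa [hγ0]) ht
  have hup : ∀ t, 0 ≤ t → phaseDiff m (γ t) j ≤ π - τ - r := fun t ht =>
    H.angle_le_of_le hγ (by linarith) (t₀ := 0) (by rwa [hγ0]) (by rw [hγ0, hpxj]) ht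
  -- A trajectory that never left would converge to the saddle, the only equilibrium in the slab;
  -- but θ_j stays at least r below its saddle value.
  obtain ⟨t₁, ht₁, hlt⟩ : ∃ t₁, 0 ≤ t₁ ∧ phaseDiff m (γ t₁) j < π - τ - η := by
    by_contra! hcon
    have hlim := tendsto_phaseDiff_atTop H.even (H.isCompact_inter (π - τ - η) (π - τ - r))
      (θ := saddle 1 a b j) (fun y hy hy0 => by
        rcases H.eq_of_force_eq_zero hφ hy.1 hy0 with h | h
        · have := hy.2.1
          linarith [h.1]
        · exact h) hγ (fun t ht => ⟨hγR t ht, hcon t ht, hup t ht⟩)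
    have hj := le_of_tendsto ((continuous_apply j).continuousAt.tendsto.comp hlim)
      ((eventually_ge_atTop 0).mono fun t ht => hup t ht)
    rw [saddle_same] at hj
    linarith
  have hc : Continuous fun t => phaseDiff m (γ t) j :=
    (continuous_apply j).comp ((continuous_phaseDiff m).comp hγ.continuous)
  obtain ⟨ts, hts, htse⟩ := intermediate_value_Icc' ht₁ hc.continuousOn
    (show π - τ - η ∈ Icc _ _ from ⟨hlt.le, by rw [hγ0, hpxj]; linarith⟩)
  simp only at htse
  have hstay : ∀ s, 0 ≤ s → s ≤ ts → π - τ - η ≤ phaseDiff m (γ s) j := by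
    intro s hs hsts
    by_contra! hcon
    have hlt' : η < min (π - τ - phaseDiff m (γ s) j) (2 * η) := lt_min (by linarith) (by linarith)
    have := H.angle_le_of_le hγ (min_le_right _ _) (hγR s hs)
      (by rw [← hτ]; linarith [min_le_left (π - τ - phaseDiff m (γ s) j) (2 * η)]) hsts
    rw [htse, ← hτ] at this
    linarith
  -- Reaching the face changes θ_j by η, whereas up to time T the distance η/4 allows a change of at
  -- most η/2.
  have hlong : T < ts := by
    by_contra! hcon
    have heq : IsEquilibrium P K δ₀ :=
      isEquilibrium_saddle H.even (Or.inl rfl) H.K_pos H.balance hδ₀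
    have hd := dist_integralCurve_le hL hγ (isTrajectory_const heq) hts.1
    simp only [hγ0, hdist] at hd
    have hexp : r * exp (L * ts) ≤ η / 4 := by
      rw [hr, mul_assoc, ← exp_add]
      have : exp (-(L * T) + L * ts) ≤ 1 := exp_le_one_iff.2 (by
        have := mul_le_mul_of_nonneg_left hcon L.2
        linarith!)
      nlinarith
    have hp := abs_le.1 (abs_phaseDiff_sub_le m (γ ts) δ₀ j)
    rw [htse, hδ₀, saddle_same, ← hτ] at hp
    linarith [hp.1]
  refine ⟨fun t => γ (t + ts) + WithLp.toLp 2 fun _ => -γ ts 0,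
    (hγ.comp_add ts).add_const _, by simp, ?_, fun t ht => ?_⟩
  · rw [phaseDiff_add_const, zero_add, htse]
  · rw [phaseDiff_add_const]
    have h0 : 0 ≤ -t + ts := by linarith [ht.2]
    exact ⟨hγR _ h0, hstay _ h0 (by linarith [ht.1]), H.le_angle_top (hγR _ h0)⟩

/-- The connection from the saddle to the synchronous state inside the capped region. -/
theorem exists_connection (H : NearSaddle m P K h η a b j) (hφ : |2 * π * m / N| < π / 2) :
    ∃ γ, IsConnection P K m (saddle 1 a b j) (syncState N m P K) γ ∧
      ∀ t, phaseDiff m (γ t) ∈ cappedRegion m a b j := by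
  obtain ⟨L, M, hL, hM⟩ := exists_lipschitz_bound_gradField (N := N) P K
  have hη := H.η_pos
  have hbd := H.h_bounds
  have hτj := H.τ_close j
  choose Φ hΦ hΦ0 using exists_trajectory (N := N) P K
  set A := cappedRegion m a b j ∩
    {θ | π - alternating a b j - η ≤ θ j ∧ θ j ≤ π - alternating a b j} with hA
  have hAc : IsCompact A := H.isCompact_inter _ _
  have hcontΦ : ∀ t, 0 ≤ t → Continuous fun y => Φ y (-t) := by
    intro t ht
    have : LipschitzWith (Real.toNNReal (exp (L * t))) fun y => Φ y (-t) := by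
      refine LipschitzWith.of_dist_le_mul fun x y => ?_
      have := dist_integralCurve_neg_le hL (hΦ x) (hΦ y) ht
      rw [hΦ0, hΦ0] at this
      rw [Real.coe_toNNReal _ (exp_pos _).le]
      linarith
    exact this.continuous
  -- Normalised points on the exit face whose backward trajectory stays in the slab for time n.
  -- These sets are compact, decreasing and nonempty by slow exit; a common point has an entire
  -- backward trajectory in the slab.
  let Y : ℕ → Set (Config N) := fun n => {y | y 0 = 0 ∧ phaseDiff m y ∈ A} ∩
    ({y | phaseDiff m y j = π - alternating a b j - η} ∩
      {y | ∀ t ∈ Icc (0 : ℝ) n, phaseDiff m (Φ y (-t)) ∈ A})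
  have hclosed : ∀ n, IsClosed ({y | phaseDiff m y j = π - alternating a b j - η} ∩
      {y | ∀ t ∈ Icc (0 : ℝ) n, phaseDiff m (Φ y (-t)) ∈ A}) := by
    intro n
    refine (isClosed_eq ((continuous_apply j).comp (continuous_phaseDiff m))
      continuous_const).inter ?_
    have e : {y | ∀ t ∈ Icc (0 : ℝ) n, phaseDiff m (Φ y (-t)) ∈ A}
        = ⋂ t ∈ Icc (0 : ℝ) n, {y | phaseDiff m (Φ y (-t)) ∈ A} := by
      ext y; simp
    rw [e]
    exact isClosed_biInter fun t ht => hAc.isClosed.preimage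
      ((continuous_phaseDiff m).comp (hcontΦ t ht.1))
  have hYc : ∀ n, IsCompact (Y n) := fun n =>
    (isCompact_setOf_phaseDiff_mem m hAc).inter_right (hclosed n)
  have hYne : ∀ n, (Y n).Nonempty := by
    intro n
    obtain ⟨γ, hγ, h00, hγj, hγA⟩ := H.exists_slow_exit hφ (T := n) n.cast_nonneg
    have huniq : Φ (γ 0) = γ := trajectory_unique (hΦ _) hγ (hΦ0 _)
    refine ⟨γ 0, ⟨h00, ?_⟩, hγj, fun t ht => ?_⟩
    · have := hγA 0 ⟨le_rfl, n.cast_nonneg⟩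
      rwa [neg_zero] at this
    · rw [huniq]
      exact hγA t ht
  obtain ⟨y, hy⟩ := IsCompact.nonempty_iInter_of_sequence_nonempty_isCompact_isClosed Y
    (fun n y hy => ⟨hy.1, hy.2.1, fun t ht => hy.2.2 t
      ⟨ht.1, ht.2.trans (by push_cast; linarith)⟩⟩) hYne (hYc 0) fun n => (hYc n).isClosed
  rw [mem_iInter] at hy
  have hback : ∀ t, t ≤ 0 → phaseDiff m (Φ y t) ∈ A := by
    intro t ht
    obtain ⟨n, hn⟩ := exists_nat_ge (-t)
    have := (hy n).2.2 (-t) ⟨by linarith, hn⟩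
    rwa [neg_neg] at this
  have hyj : phaseDiff m (Φ y 0) j = π - alternating a b j - η := by
    rw [hΦ0]; exact (hy 0).2.1
  have hyR : phaseDiff m (Φ y 0) ∈ cappedRegion m a b j := (hback 0 le_rfl).1
  have hforw : ∀ t, 0 ≤ t → phaseDiff m (Φ y t) ∈ cappedRegion m a b j := fun t ht =>
    H.forwardInvariant_cappedRegion.mem (hΦ y) hyR ht
  refine ⟨Φ y, ⟨hΦ y, ?_, ?_⟩, fun t => ?_⟩
  · refine tendsto_phaseDiff_atBot H.even hAc (fun θ hθ hf => ?_) (hΦ y) hback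
    rcases H.eq_of_force_eq_zero hφ hθ.1 hf with h | h
    · have := hθ.2.1
      linarith [h.1]
    · exact h
  · refine tendsto_phaseDiff_atTop H.even (H.isCompact_inter (alternating a b j)
      (π - alternating a b j - η)) (fun θ hθ hf => ?_) (hΦ y) fun t ht => ⟨hforw t ht, ?_, ?_⟩
    · rcases H.eq_of_force_eq_zero hφ hθ.1 hf with h | h
      · exact h.2
      · have := hθ.2.2
        rw [h, saddle_same] at this
        linarith
    · exact (hforw t ht).1 j
    · exact H.angle_le_of_le (hΦ y) (by linarith) hyR hyj.le ht
  · rcases le_total 0 t with ht | ht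
    · exact hforw t ht
    · exact (hback t ht).1

end NearSaddle

/-! ### The region I for P = 0 and s = 1. -/

section Region

variable {m : ℤ} {K : ℝ}

theorem two_pi_mul_eq (hN2 : 2 < N) (m : ℤ) :
    2 * π * m = ((N : ℝ) - 2) * hatAngle N m 1 + π := by
  rw [hatAngle_mul hN2]; ring

theorem sum_sub_hatAngle (hN2 : 2 < N) {θ : Fin N → ℝ} (hθ : ∑ i, θ i = 2 * π * m) :
    ∑ i, (θ i - hatAngle N m 1) = π - 2 * hatAngle N m 1 := by
  rw [Finset.sum_sub_distrib, hθ, two_pi_mul_eq hN2]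
  simp
  ring

/-- The upper bounds follow from the lower ones and the sum, because no angle can exceed θ̂ by more
than the budget π - 2θ̂. -/
theorem mem_region_one_iff (hN2 : 2 < N) (hm : |hatAngle N m 1| < π / 2) {θ : Fin N → ℝ} :
    θ ∈ region N m 1 ↔ (∀ i, hatAngle N m 1 ≤ θ i) ∧ ∑ i, θ i = 2 * π * m := by
  have hm' := abs_lt.1 hm
  unfold region
  rw [mem_ofPred_eq, uIcc_of_le (by linarith)]
  refine and_congr_left fun hsum => ⟨fun h i => (h i).1, fun h i => ⟨h i, ?_⟩⟩
  have := le_add_sum_sub h i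
  rw [sum_sub_hatAngle hN2 hsum] at this
  linarith

theorem region_one_le (hN2 : 2 < N) {θ : Fin N → ℝ}
    (hθ : (∀ i, hatAngle N m 1 ≤ θ i) ∧ ∑ i, θ i = 2 * π * m) (i : Fin N) :
    θ i ≤ π - hatAngle N m 1 := by
  have := le_add_sum_sub hθ.1 i
  rw [sum_sub_hatAngle hN2 hθ.2] at this
  linarith

theorem force_sub_force_zero (hN : Even N) (hK : 0 < K) (h : ℝ) (θ : Fin N → ℝ) (i : Fin N) :
    force 0 K θ i - force 0 K θ (i - 1) =
      K * (sin (θ (i + 1)) + sin (θ (i - 1)) - 2 * sin (θ i)) := by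
  rw [force_sub_force hN hK (a := h) (b := h) (by simp)]
  simp only [alternating_self]
  ring

/-- With a = b = θ̂ the budget bounds all angles by π - θ̂, not only one, so no caps are needed. -/
theorem forwardInvariant_region_one (hN : Even N) (hN2 : 2 < N) (hK : 0 < K)
    (hm : |hatAngle N m 1| < π / 2) : ForwardInvariant (N := N) 0 K m (region N m 1) := by
  have hm' := abs_lt.1 hm
  intro T γ hT hγ h0 t ht
  rw [mem_region_one_iff hN2 hm] at h0 ⊢
  set h := hatAngle N m 1 with hh
  have key := constraints_propagate (P := 0) (K := K) (m := m) (S := {θ | ∑ i, θ i = 2 * π * m})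
    (C := 4 * K) (by linarith) (id : Fin N → Fin N) (fun _ => -1) (fun _ => -h) ?_ hγ
    (fun t _ => sum_phaseDiff m (γ t)) ?_
  · refine ⟨fun i => ?_, sum_phaseDiff m (γ t)⟩
    have := key i t ht
    simp only [id] at this
    linarith
  · intro θ hθ c hc
    change ∑ i, θ i = 2 * π * m at hθ
    simp only [id] at hc ⊢
    have e : ∑ d, max (-1 * θ d - -h) 0 = ∑ d, max (h - θ d) 0 :=
      Finset.sum_congr rfl fun d _ => by congr 1; ring
    rw [e, force_sub_force_zero hN hK h]
    set Q := ∑ d, max (h - θ d) 0 with hQ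
    have hnn : ∀ i, 0 ≤ max (h - θ i) 0 := fun i => le_max_right _ _
    have hQ0 : 0 ≤ Q := Finset.sum_nonneg fun i _ => hnn i
    have hni : ∀ i, max (h - θ i) 0 ≤ Q := fun i =>
      Finset.single_le_sum (f := fun i => max (h - θ i) 0) (fun i _ => hnn i) (Finset.mem_univ i)
    have hlow : ∀ i, sin h - Q ≤ sin (θ i) := by
      intro i
      refine sin_sub_le_sin ⟨by linarith, by linarith⟩ hQ0
        (by linarith [le_max_left (h - θ i) 0, hni i]) ?_
      have h1 : ∀ k, 0 ≤ (θ k - h) + max (h - θ k) 0 := fun k => by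
        linarith [le_max_left (h - θ k) 0]
      have h2 := Finset.single_le_sum (f := fun k => (θ k - h) + max (h - θ k) 0)
        (fun k _ => h1 k) (Finset.mem_univ i)
      rw [Finset.sum_add_distrib, sum_sub_hatAngle hN2 hθ] at h2
      linarith [hnn i]
    have hup : sin (θ c) ≤ sin h + Q := by
      have h1 := (abs_le.1 (abs_sin_sub_sin_le (θ c) h)).2
      rw [abs_of_nonpos (by linarith)] at h1
      linarith [le_max_left (h - θ c) 0, hni c]
    have e := mul_le_mul_of_nonneg_left (by linarith [hlow (c + 1), hlow (c - 1)] :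
      -(sin (θ (c + 1)) + sin (θ (c - 1)) - 2 * sin (θ c)) ≤ 4 * Q) hK.le
    linarith
  · intro i
    simp only [id]
    linarith [h0.1 i]

/-- Angles above `π/2` decrease inside the region. -/
theorem force_sub_nonpos_of_region (hN : Even N) (hN2 : 2 < N) (hK : 0 < K)
    (hm : |hatAngle N m 1| < π / 2) {θ : Fin N → ℝ}
    (hθ : (∀ i, hatAngle N m 1 ≤ θ i) ∧ ∑ i, θ i = 2 * π * m) {k : Fin N} (hk : π / 2 ≤ θ k) :
    force 0 K θ k - force 0 K θ (k - 1) ≤ 0 := by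
  have hm' := abs_lt.1 hm
  rw [force_sub_force_zero hN hK 0]
  set h := hatAngle N m 1
  -- After θ_k has taken its share of the budget, each neighbour is at most π - θ_k ≤ π/2, so its
  -- sine does not exceed sin θ_k.
  have h3 := three_le_sum hN2 (f := fun i => θ i - h) (fun i => sub_nonneg.2 (hθ.1 i)) k
  rw [sum_sub_hatAngle hN2 hθ.2] at h3
  have hle : ∀ i, h ≤ θ i → θ i ≤ π - θ k → sin (θ i) ≤ sin (θ k) := by
    intro i h1 h2
    rw [← sin_pi_sub (θ k)]
    exact strictMonoOn_sin.monotoneOn ⟨by linarith, by linarith⟩ ⟨by linarith, by linarith⟩ h2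
  have e1 := hle (k + 1) (hθ.1 _) (by linarith [hθ.1 (k - 1)])
  have e2 := hle (k - 1) (hθ.1 _) (by linarith [hθ.1 (k + 1)])
  exact mul_nonpos_of_nonneg_of_nonpos hK.le (by linarith)

/-- At an equilibrium all sines agree. If some θ_k exceeded π/2, every angle would be at least π -
θ_k, and the sum would then force θ_k ≥ π - θ̂, which `htop` excludes. -/
theorem eq_syncState_of_region (hN : Even N) (hN2 : 2 < N) (hK : 0 < K)
    (hm : |hatAngle N m 1| < π / 2) {θ : Fin N → ℝ}
    (hθ : (∀ i, hatAngle N m 1 ≤ θ i) ∧ ∑ i, θ i = 2 * π * m)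
    (htop : ∀ i, θ i < π - hatAngle N m 1) (hf : force 0 K θ = 0) : θ = syncState N m 0 K := by
  have hm' := abs_lt.1 hm
  set h := hatAngle N m 1 with hh
  have hsin : ∀ i j, sin (θ i) = sin (θ j) := by
    refine eq_const_of_add_one (f := fun i => sin (θ i)) fun i => ?_
    have := congrFun hf i
    rw [force_eq_of_balance hN hK (a := 0) (b := 0) (by simp), Pi.zero_apply, mul_eq_zero] at this
    have := this.resolve_left hK.ne'
    simp only [alternating_self] at this
    linarith
  have hN0 : (N : ℝ) ≠ 0 := by positivity
  by_cases hall : ∀ i, θ i ≤ π / 2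
  · have hc : ∀ i, θ i = θ 0 := fun i =>
      injOn_sin ⟨by linarith [hθ.1 i], hall i⟩ ⟨by linarith [hθ.1 0], hall 0⟩ (hsin i 0)
    have hs : (N : ℝ) * θ 0 = 2 * π * m := by
      rw [← hθ.2, Finset.sum_congr rfl fun i _ => hc i]; simp
    funext i
    rw [hc i]
    unfold syncState
    simp only [zero_div, arcsin_zero, neg_zero, zero_add, alternating_self]
    rw [eq_div_iff hN0, ← hs]; ring
  · push Not at hall
    obtain ⟨k, hk⟩ := hall
    exfalso
    have hkt := htop k
    have hge : ∀ i, π - θ k ≤ θ i := by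
      intro i
      rcases le_or_gt (θ i) (π / 2) with hi | hi
      · have : θ i = π - θ k := injOn_sin ⟨by linarith [hθ.1 i], hi⟩
          ⟨by linarith, by linarith⟩ (by rw [sin_pi_sub]; exact hsin i k)
        exact this.ge
      · linarith
    have h1 := le_add_sum_sub (τ := fun _ => π - θ k) hge k
    rw [Finset.sum_sub_distrib, hθ.2, two_pi_mul_eq hN2, ← hh] at h1
    simp only [Finset.sum_const, Finset.card_univ, Fintype.card_fin, nsmul_eq_mul] at h1
    have h2 : (2 : ℝ) < N := by exact_mod_cast hN2
    nlinarith

theorem isCompact_region_one_inter (m : ℤ) (c : Fin N → ℝ) :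
    IsCompact {θ : Fin N → ℝ | ((∀ i, hatAngle N m 1 ≤ θ i) ∧ ∑ i, θ i = 2 * π * m) ∧
      ∀ i, θ i ≤ c i} := by
  refine (isCompact_Icc (a := fun _ => hatAngle N m 1) (b := c)).of_isClosed_subset ?_
    fun θ hθ => ⟨hθ.1.1, hθ.2⟩
  simp only [ofPred_and, ofPred_forall]
  exact ((isClosed_iInter fun i => isClosed_le continuous_const (continuous_apply i)).inter
    (isClosed_eq (by fun_prop) continuous_const)).inter
    (isClosed_iInter fun i => isClosed_le (continuous_apply i) continuous_const)

/-- Trajectories in the region that do not start at a saddle converge to the synchronous state. -/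
theorem tendsto_of_mem_region_one (hN : Even N) (hN2 : 2 < N) (hK : 0 < K)
    (hm : |hatAngle N m 1| < π / 2) {γ : ℝ → Config N} (hγ : IsTrajectory 0 K γ)
    (h0 : phaseDiff m (γ 0) ∈ region N m 1)
    (hne : ∀ k, phaseDiff m (γ 0) ≠ saddle 1 (hatAngle N m 1) (hatAngle N m 1) k) :
    Tendsto (fun t => phaseDiff m (γ t)) atTop (𝓝 (syncState N m 0 K)) := by
  have hm' := abs_lt.1 hm
  have hreg : ∀ t, 0 ≤ t → (∀ i, hatAngle N m 1 ≤ phaseDiff m (γ t) i) ∧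
      ∑ i, phaseDiff m (γ t) i = 2 * π * m := fun t ht =>
    (mem_region_one_iff hN2 hm).1 ((forwardInvariant_region_one hN hN2 hK hm).mem hγ h0 ht)
  set h := hatAngle N m 1 with hh
  have h0' := hreg 0 le_rfl
  have htop : ∀ k, phaseDiff m (γ 0) k < π - h := by
    intro k
    -- An angle equal to π - θ̂ uses up the budget, so all others equal θ̂ and the starting point is
    -- a saddle.
    refine lt_of_le_of_ne (region_one_le hN2 h0' k) fun he => hne k ?_
    have hsum := sum_sub_hatAngle hN2 h0'.2
    rw [← hh, ← Finset.add_sum_erase _ _ (Finset.mem_univ k), he] at hsum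
    have hz : ∑ i ∈ Finset.univ.erase k, (phaseDiff m (γ 0) i - h) = 0 := by linarith
    rw [Finset.sum_eq_zero_iff_of_nonneg fun i _ => sub_nonneg.2 (h0'.1 i)] at hz
    funext i
    by_cases hi : i = k
    · rw [hi, he, saddle_same, alternating_self, one_mul]
    · rw [saddle_of_ne _ _ _ hi, alternating_self]
      exact sub_eq_zero.1 (hz i (Finset.mem_erase.2 ⟨hi, Finset.mem_univ i⟩))
  -- Angles at or above π/2 cannot increase, so these caps persist; they lie strictly below π - θ̂
  -- and cut all saddles out of the compact set.
  set c : Fin N → ℝ := fun k => max (phaseDiff m (γ 0) k) (π / 2) with hc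
  have hcap : ∀ t, 0 ≤ t → ∀ k, phaseDiff m (γ t) k ≤ c k := by
    intro t ht k
    have key := constraints_propagate (P := 0) (K := K) (m := m)
      (S := {θ | (∀ i, h ≤ θ i) ∧ ∑ i, θ i = 2 * π * m}) (C := 0) le_rfl
      (id : Fin N → Fin N) (fun _ => 1) c ?_ (hγ.isIntegralCurveOn (Icc 0 t))
      (fun s hs => hreg s hs.1) ?_ k t ⟨ht, le_rfl⟩
    · simp only [id, one_mul] at key
      linarith
    · intro θ hθ i hi
      simp only [id, one_mul, zero_mul] at hi ⊢
      exact force_sub_nonpos_of_region hN hN2 hK hm hθ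
        (by linarith [le_max_right (phaseDiff m (γ 0) i) (π / 2)])
    · intro i
      simp only [id, one_mul]
      linarith [le_max_left (phaseDiff m (γ 0) i) (π / 2)]
  refine tendsto_phaseDiff_atTop hN (isCompact_region_one_inter m c) (fun θ hθ hf => ?_) hγ
    fun t ht => ⟨hreg t ht, hcap t ht⟩
  exact eq_syncState_of_region hN hN2 hK hm hθ.1
    (fun i => (hθ.2 i).trans_lt (max_lt (htop i) (by linarith))) hf

end Region

end Connection

/-! ### The reflection δ ↦ -δ and the case s = -1. -/

section Reflection

variable {N : ℕ} [NeZero N]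

theorem phaseDiff_neg (m : ℤ) (δ : Config N) : phaseDiff (-m) (-δ) = -phaseDiff m δ := by
  funext i
  simp only [phaseDiff, PiLp.neg_apply, Pi.neg_apply]
  split_ifs
  · push_cast; ring
  · ring

theorem force_neg (P K : ℝ) (θ : Fin N → ℝ) : force (-P) K (-θ) = -force P K θ := by
  funext i
  simp only [force, power, Pi.neg_apply, sin_neg]
  ring

theorem gradField_neg (P K : ℝ) (δ : Config N) : gradField (-P) K (-δ) = -gradField P K δ := by
  rw [gradField_eq (-P) K (-0), phaseDiff_neg, force_neg, gradField_eq P K 0, WithLp.toLp_neg]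

theorem IsTrajectory.neg {P K : ℝ} {γ : ℝ → Config N} (h : IsTrajectory P K γ) :
    IsTrajectory (-P) K fun t => -γ t := fun t =>
  (h t).fun_neg.congr_deriv (gradField_neg P K (γ t)).symm

theorem syncState_neg (m : ℤ) (P K : ℝ) : syncState N (-m) (-P) K = -syncState N m P K := by
  funext i
  have e : 2 * π * ((-m : ℤ) : ℝ) / N = -(2 * π * m / N) := by push_cast; ring
  simp only [syncState, alternating, Pi.neg_apply, e, cos_neg, neg_div, arcsin_neg]
  split_ifs <;> ring

theorem alternating_neg (a b : ℝ) (i : Fin N) : alternating (-a) (-b) i = -alternating a b i := by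
  unfold alternating
  split_ifs <;> rfl

theorem saddle_neg (s a b : ℝ) (j : Fin N) : saddle (-s) (-a) (-b) j = -saddle s a b j := by
  funext i
  by_cases h : i = j
  · subst h
    rw [Pi.neg_apply, saddle_same, saddle_same, alternating_neg]; ring
  · rw [Pi.neg_apply, saddle_of_ne _ _ _ h, saddle_of_ne _ _ _ h, alternating_neg]

theorem hatAngle_neg (m : ℤ) (s : ℝ) : hatAngle N (-m) (-s) = -hatAngle N m s := by
  unfold hatAngle
  push_cast
  ring

theorem neg_mem_region {m : ℤ} {s : ℝ} {θ : Fin N → ℝ} (h : θ ∈ region N m s) :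
    -θ ∈ region N (-m) (-s) := by
  obtain ⟨h1, h2⟩ := h
  refine ⟨fun i => ?_, ?_⟩
  · rw [hatAngle_neg, show -s * π - -hatAngle N m s = -(s * π - hatAngle N m s) by ring]
    have := h1 i
    rw [mem_uIcc] at this ⊢
    rw [Pi.neg_apply]
    rcases this with h | h
    · right; constructor <;> linarith [h.1, h.2]
    · left; constructor <;> linarith [h.1, h.2]
  · simp only [Pi.neg_apply, Finset.sum_neg_distrib, h2]
    push_cast
    ring

theorem mem_region_of_neg {m : ℤ} {s : ℝ} {θ : Fin N → ℝ} (h : -θ ∈ region N (-m) (-s)) :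
    θ ∈ region N m s := by
  simpa using neg_mem_region h

theorem mem_region_iff (hN2 : 2 < N) {m : ℤ} {s : ℝ} (hs : s = 1 ∨ s = -1)
    (hm : |hatAngle N m s| < π / 2) {θ : Fin N → ℝ} :
    θ ∈ region N m s ↔ (∀ i, 0 ≤ s * (θ i - hatAngle N m s)) ∧ ∑ i, θ i = 2 * π * m := by
  rcases hs with rfl | rfl
  · rw [mem_region_one_iff hN2 hm]
    simp only [one_mul, sub_nonneg]
  · have hm' : |hatAngle N (-m) 1| < π / 2 := by
      rw [← abs_neg, ← hatAngle_neg, neg_neg]; exact hm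
    have e : hatAngle N (-m) 1 = -hatAngle N m (-1) := by rw [← hatAngle_neg, neg_neg]
    have h1 : θ ∈ region N m (-1) ↔ -θ ∈ region N (-m) 1 := by
      constructor
      · intro h
        have := neg_mem_region h
        rwa [neg_neg] at this
      · intro h
        apply mem_region_of_neg
        rwa [neg_neg]
    rw [h1, mem_region_one_iff hN2 hm', e]
    simp only [Pi.neg_apply, Finset.sum_neg_distrib]
    refine and_congr (forall_congr' fun i => ?_) ?_
    · constructor <;> intro h <;> linarith
    · push_cast
      constructor <;> intro h <;> linarith

theorem forwardInvariant_region (hN : Even N) (hN2 : 2 < N) {m : ℤ} {s K : ℝ}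
    (hs : s = 1 ∨ s = -1) (hK : 0 < K) (hm : |hatAngle N m s| < π / 2) :
    ForwardInvariant (N := N) 0 K m (region N m s) := by
  rcases hs with rfl | rfl
  · exact forwardInvariant_region_one hN hN2 hK hm
  · have hm' : |hatAngle N (-m) 1| < π / 2 := by
      rw [← abs_neg, ← hatAngle_neg, neg_neg]; exact hm
    have key := forwardInvariant_region_one hN hN2 hK hm'
    intro T γ hT hγ h0 t ht
    apply mem_region_of_neg
    have := key T (fun t => -γ t) hT (fun t ht => (hγ t ht).fun_neg.congr_deriv ?_) ?_ t ht
    · rwa [phaseDiff_neg, ← neg_neg (1 : ℝ)] at this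
    · have := gradField_neg 0 K (γ t)
      rw [neg_zero] at this
      exact this.symm
    · have := neg_mem_region h0
      rwa [neg_neg, ← phaseDiff_neg] at this

theorem tendsto_of_mem_region (hN : Even N) (hN2 : 2 < N) {m : ℤ} {s K : ℝ}
    (hs : s = 1 ∨ s = -1) (hK : 0 < K) (hm : |hatAngle N m s| < π / 2) {γ : ℝ → Config N}
    (hγ : IsTrajectory 0 K γ) (h0 : phaseDiff m (γ 0) ∈ region N m s)
    (hne : ∀ k, phaseDiff m (γ 0) ≠ saddle s (hatAngle N m s) (hatAngle N m s) k) :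
    Tendsto (fun t => phaseDiff m (γ t)) atTop (𝓝 (syncState N m 0 K)) := by
  rcases hs with rfl | rfl
  · exact tendsto_of_mem_region_one hN hN2 hK hm hγ h0 hne
  · have e : hatAngle N (-m) 1 = -hatAngle N m (-1) := by rw [← hatAngle_neg, neg_neg]
    have hm' : |hatAngle N (-m) 1| < π / 2 := by rw [e, abs_neg]; exact hm
    have hγ' := hγ.neg
    rw [neg_zero] at hγ'
    have key := tendsto_of_mem_region_one hN hN2 hK hm' hγ' ?_ fun k hk => hne k ?_
    · have h2 := key.neg
      simp only [phaseDiff_neg, neg_neg] at h2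
      have h3 := syncState_neg (N := N) m 0 K
      rw [neg_zero] at h3
      rwa [h3, neg_neg] at h2
    · have := neg_mem_region h0
      rwa [neg_neg, ← phaseDiff_neg] at this
    · have h2 := saddle_neg (-1) (hatAngle N m (-1)) (hatAngle N m (-1)) k
      rw [neg_neg] at h2
      rw [e, h2, phaseDiff_neg, neg_inj] at hk
      exact hk

/-- How small the distance of the saddle angles to `θ̂` has to be. -/
def SmallParam (h η : ℝ) : Prop :=
  0 < η ∧ 16 * η ≤ cos h ∧ 10 * η ≤ 1 - sin (π / 4 + |h| / 2)

theorem exists_smallParam {h : ℝ} (hh : |h| < π / 2) : ∃ η, SmallParam h η := by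
  have h1 : 0 < cos h := cos_pos_of_mem_Ioo ⟨(abs_lt.1 hh).1, (abs_lt.1 hh).2⟩
  have h2 : sin (π / 4 + |h| / 2) < 1 := by
    rw [← sin_pi_div_two]
    exact strictMonoOn_sin ⟨by linarith [abs_nonneg h, pi_pos], by linarith⟩
      ⟨by linarith [pi_pos], le_rfl⟩ (by linarith)
  refine ⟨min (cos h / 16) ((1 - sin (π / 4 + |h| / 2)) / 10),
    lt_min (by linarith) (by linarith), ?_, ?_⟩
  · linarith [min_le_left (cos h / 16) ((1 - sin (π / 4 + |h| / 2)) / 10)]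
  · linarith [min_le_right (cos h / 16) ((1 - sin (π / 4 + |h| / 2)) / 10)]

theorem nearSaddle_of_isSaddleAngles (hN : Even N) (hN2 : 2 < N) {m : ℤ} {P K η a b : ℝ}
    {j : Fin N} (hK : 0 < K) (hm : |hatAngle N m 1| < π / 2)
    (hη : SmallParam (hatAngle N m 1) η) (hab : IsSaddleAngles P K m 1 j a b)
    (ha : |a - hatAngle N m 1| ≤ η) (hb : |b - hatAngle N m 1| ≤ η) :
    NearSaddle m P K (hatAngle N m 1) η a b j where
  even := hN
  two_lt := hN2
  K_pos := hK
  abs_lt := hm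
  η_pos := hη.1
  η_cos := hη.2.1
  η_sin := by
    -- `SmallParam` uses |h| so that it survives the reflection; monotonicity of the sine recovers
    -- the condition on h.
    refine hη.2.2.trans (sub_le_sub_left (strictMonoOn_sin.monotoneOn ⟨?_, ?_⟩ ⟨?_, ?_⟩ ?_) 1) <;>
      linarith [neg_abs_le (hatAngle N m 1), le_abs_self (hatAngle N m 1), pi_pos,
        abs_nonneg (hatAngle N m 1)]
  close_a := ha
  close_b := hb
  balance := hab.2.2.1
  sum_eq := hab.2.2.2

theorem exists_connection_saddle (hN : Even N) (hN2 : 2 < N) {m : ℤ} {s P K η a b : ℝ}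
    (hs : s = 1 ∨ s = -1) {j : Fin N} (hK : 0 < K) (hm : |hatAngle N m s| < π / 2)
    (hη : SmallParam (hatAngle N m s) η) (hab : IsSaddleAngles P K m s j a b)
    (ha : |a - hatAngle N m s| ≤ η) (hb : |b - hatAngle N m s| ≤ η) :
    ∃ γ, IsConnection P K m (saddle s a b j) (syncState N m P K) γ ∧
      ∀ t i, 0 ≤ s * (phaseDiff m (γ t) i - alternating a b i) := by
  have hφ := abs_winding_lt hN2 hs hm
  rcases hs with rfl | rfl
  · obtain ⟨γ, h1, h2⟩ :=
      (nearSaddle_of_isSaddleAngles hN hN2 hK hm hη hab ha hb).exists_connection hφ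
    refine ⟨γ, h1, fun t i => ?_⟩
    linarith [(h2 t).1 i]
  · have e : hatAngle N (-m) 1 = -hatAngle N m (-1) := by rw [← hatAngle_neg, neg_neg]
    have hsad : ∀ a b, saddle 1 (-a) (-b) j = -saddle (-1) a b j := fun a b => by
      rw [← saddle_neg, neg_neg]
    have hclose : ∀ x, |x - hatAngle N m (-1)| ≤ η → |-x - hatAngle N (-m) 1| ≤ η := by
      intro x hx
      rwa [e, ← abs_neg, show -(-x - -hatAngle N m (-1)) = x - hatAngle N m (-1) by ring]
    have hab' : IsSaddleAngles (-P) K (-m) 1 j (-a) (-b) := by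
      obtain ⟨h1, h2, h3, h4⟩ := hab
      refine ⟨⟨by linarith [h1.2], by linarith [h1.1]⟩, ⟨by linarith [h2.2], by linarith [h2.1]⟩,
        ?_, ?_⟩
      · rw [sin_neg, sin_neg, neg_div, ← h3]; ring
      · rw [hsad]
        simp only [Pi.neg_apply, Finset.sum_neg_distrib, h4]
        push_cast
        ring
    have hφ' : |2 * π * ((-m : ℤ) : ℝ) / N| < π / 2 := by
      rwa [← abs_neg, show -(2 * π * ((-m : ℤ) : ℝ) / N) = 2 * π * m / N by push_cast; ring]
    have hη' : SmallParam (hatAngle N (-m) 1) η := by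
      rw [e]
      unfold SmallParam
      rw [cos_neg, abs_neg]
      exact hη
    obtain ⟨γ, ⟨h1, h2, h3⟩, h4⟩ := (nearSaddle_of_isSaddleAngles hN hN2 hK
      (by rw [e, abs_neg]; exact hm) hη' hab' (hclose a ha) (hclose b hb)).exists_connection hφ'
    have hpd : ∀ t, phaseDiff m (-γ t) = -phaseDiff (-m) (γ t) := fun t => by
      rw [← phaseDiff_neg, neg_neg]
    refine ⟨fun t => -γ t, ⟨?_, ?_, ?_⟩, fun t i => ?_⟩
    · have := h1.neg
      rwa [neg_neg] at this
    · simp only [hpd]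
      have := h2.neg
      rwa [hsad, neg_neg] at this
    · simp only [hpd]
      have := h3.neg
      rwa [syncState_neg, neg_neg] at this
    · have := (h4 t).1 i
      rw [hpd, Pi.neg_apply]
      rw [alternating_neg] at this
      linarith

end Reflection

/-! ### Saddles on the boundary of the basin. -/

section Boundary

variable {N : ℕ} [NeZero N]

/-- This distinguishes the saddle from the synchronous state without comparing angles. -/
theorem IsStableEquilibrium.not_isType_one {P K α : ℝ} {δ : Config N}
    (h : IsStableEquilibrium P K α δ) : ¬IsTypeEquilibrium P K α 1 δ := by
  classical
  intro ht
  obtain ⟨μ, hμ, hpos⟩ := Multiset.countP_pos.1 (ht.2.symm ▸ one_pos)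
  have h0 : μ ≠ 0 := by rintro rfl; simp at hpos
  exact absurd (h.2.2 μ hμ h0) (not_lt.2 hpos.le)

/-- An equilibrium that is connected to another one lies on the boundary of the basin of the
latter. -/
theorem mem_pebs_of_connection {P K : ℝ} {m : ℤ} {T θ : Fin N → ℝ} {γ : ℝ → Config N}
    (hγ : IsConnection P K m T θ γ) (hne : T ≠ θ) {δ : Config N} (hδ : phaseDiff m δ = T)
    (heq : IsEquilibrium P K δ) : δ ∈ pebs P K m θ := by
  obtain ⟨h1, h2, h3⟩ := hγ
  refine ⟨?_, fun hint => ?_⟩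
  -- Only the phase differences of γ are known to converge, so each point is shifted to agree with δ
  -- at node 0; the shifted points remain in the basin.
  · have hlim : Tendsto (fun t => γ t + WithLp.toLp 2 fun _ => δ 0 - γ t 0) atBot (𝓝 δ) := by
      refine tendsto_of_phaseDiff (m := m) ?_ fun t => by simp
      simp only [phaseDiff_add_const, hδ]
      exact h2
    refine mem_closure_of_tendsto hlim (Eventually.of_forall fun t => ?_)
    refine ⟨fun r => γ (r + t) + WithLp.toLp 2 fun _ => δ 0 - γ t 0,
      (h1.comp_add t).add_const _, by simp, ?_⟩
    simp only [phaseDiff_add_const]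
    exact h3.comp (tendsto_atTop_add_const_right _ t tendsto_id)
  · obtain ⟨γ', h1', h0', hlim'⟩ := interior_subset hint
    have := trajectory_unique h1' (isTrajectory_const heq) h0'
    rw [this] at hlim'
    simp only [hδ] at hlim'
    exact hne (tendsto_nhds_unique tendsto_const_nhds hlim')

/-- Both cosines are within η of cos h ≥ 16 η, which leaves ample room for the factor 2. -/
theorem cos_lt_two_mul_cos {h η a b : ℝ} (hη : SmallParam h η) (ha : |a - h| ≤ η)
    (hb : |b - h| ≤ η) : 0 < cos a ∧ cos b < 2 * cos a := by
  have h1 := abs_le.1 ((abs_cos_sub_cos_le a h).trans ha)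
  have h2 := abs_le.1 ((abs_cos_sub_cos_le b h).trans hb)
  have h3 := hη.1
  have h4 := hη.2.1
  constructor <;> linarith

end Boundary

end RingGrid

/-! ### Assembly of the two cases. -/

theorem mainTheorem5 (N : ℕ) [NeZero N] (hN : Even N) (hN2 : 2 < N) (m : ℤ) (s : ℝ) (hs : s = 1 ∨ s = -1)
    (hm : |RingGrid.hatAngle N m s| < π / 2) :
    -- the case `P = 0`
    (∀ K : ℝ, 0 < K →
      RingGrid.ForwardInvariant (N := N) 0 K m (RingGrid.region N m s) ∧
      RingGrid.syncState N m 0 K ∈ RingGrid.region N m s ∧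
      (∀ δ : RingGrid.Config N, RingGrid.phaseDiff m δ = RingGrid.syncState N m 0 K →
        ∀ α : ℝ, 0 < α → RingGrid.IsStableEquilibrium 0 K α δ) ∧
      ∀ (j : Fin N) (T : Fin N → ℝ),
        T = RingGrid.saddle s (RingGrid.hatAngle N m s) (RingGrid.hatAngle N m s) j →
        T ∈ RingGrid.region N m s ∧
        (∀ δ : RingGrid.Config N, RingGrid.phaseDiff m δ = T →
          ∀ α : ℝ, 0 < α → RingGrid.IsTypeEquilibrium 0 K α 1 δ) ∧
        (∃ γ : ℝ → RingGrid.Config N,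
          RingGrid.IsConnection 0 K m T (RingGrid.syncState N m 0 K) γ ∧
          ∀ t, RingGrid.phaseDiff m (γ t) ∈ RingGrid.region N m s) ∧
        (∀ x ∈ RingGrid.unstableManifold (N := N) 0 K m T,
          RingGrid.phaseDiff m x ∈ RingGrid.region N m s → RingGrid.phaseDiff m x ≠ T →
          x ∈ RingGrid.basin 0 K m (RingGrid.syncState N m 0 K)) ∧
        ∀ δ : RingGrid.Config N, RingGrid.phaseDiff m δ = T →
          δ ∈ RingGrid.pebs 0 K m (RingGrid.syncState N m 0 K)) ∧
    -- small `P / K`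
    (∃ ε : ℝ, 0 < ε ∧ ∀ P K : ℝ, 0 < K → |P| / K < ε →
      (∀ δ : RingGrid.Config N, RingGrid.phaseDiff m δ = RingGrid.syncState N m P K →
        ∀ α : ℝ, 0 < α → RingGrid.IsStableEquilibrium P K α δ) ∧
      ∀ j : Fin N,
        (∃! p : ℝ × ℝ, RingGrid.IsSaddleAngles P K m s j p.1 p.2) ∧
        ∀ (a b : ℝ) (T : Fin N → ℝ), RingGrid.IsSaddleAngles P K m s j a b →
          T = RingGrid.saddle s a b j →
          (∀ δ : RingGrid.Config N, RingGrid.phaseDiff m δ = T →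
            ∀ α : ℝ, 0 < α → RingGrid.IsTypeEquilibrium P K α 1 δ) ∧
          (∃ γ : ℝ → RingGrid.Config N,
            RingGrid.IsConnection P K m T (RingGrid.syncState N m P K) γ) ∧
          ∀ δ : RingGrid.Config N, RingGrid.phaseDiff m δ = T →
            δ ∈ RingGrid.pebs P K m (RingGrid.syncState N m P K)) := by
  open RingGrid in
  have hφ := abs_winding_lt hN2 hs hm
  have hφ' := abs_lt.1 hφ
  have hm' := abs_lt.1 hm
  have hcos : 0 < 2 * cos (2 * π * m / N) ^ 2 := by
    have := cos_pos_of_mem_Ioo (x := 2 * π * m / N) ⟨hφ'.1, hφ'.2⟩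
    positivity
  obtain ⟨η, hη⟩ := exists_smallParam hm
  set h := hatAngle N m s with hh
  have hs1 : s * s = 1 := by rcases hs with rfl | rfl <;> norm_num
  have hsh : 0 < π - 2 * (s * h) := by rcases hs with rfl | rfl <;> linarith
  have hmul := hatAngle_mul hN2 m s
  rw [← hh] at hmul
  have hcl : |h - h| ≤ η := by rw [sub_self, abs_zero]; exact hη.1.le
  have core : ∀ (P K : ℝ), 0 < K → |P| / K < 2 * cos (2 * π * m / N) ^ 2 → ∀ (j : Fin N) (a b : ℝ),
      IsSaddleAngles P K m s j a b → |a - h| ≤ η → |b - h| ≤ η → ∀ δ : Config N,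
      phaseDiff m δ = saddle s a b j → (∀ α : ℝ, 0 < α → IsTypeEquilibrium P K α 1 δ) ∧
        δ ∈ pebs P K m (syncState N m P K) := by
    intro P K hK hP j a b hab ha hb δ hδ
    obtain ⟨c1, c2⟩ := cos_lt_two_mul_cos hη ha hb
    obtain ⟨c3, c4⟩ := cos_lt_two_mul_cos hη hb ha
    have htype : ∀ α : ℝ, 0 < α → IsTypeEquilibrium P K α 1 δ := fun α hα =>
      isTypeEquilibrium_saddle hN hN2 hs hK hab.2.2.1 c1 c3 c2 c4 hδ hα
    obtain ⟨γ, hγ, -⟩ := exists_connection_saddle hN hN2 hs hK hm hη hab ha hb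
    refine ⟨htype, mem_pebs_of_connection hγ (fun he => ?_) hδ (htype 1 one_pos).1⟩
    exact (isStableEquilibrium_syncState hN hN2 hK hφ hP (hδ.trans he) one_pos).not_isType_one
      (htype 1 one_pos)
  refine ⟨fun K hK => ?_, ?_⟩
  · have hP : |(0 : ℝ)| / K < 2 * cos (2 * π * m / N) ^ 2 := by simpa using hcos
    have hNpos : (0 : ℝ) < N := by positivity
    have hab : ∀ j : Fin N, IsSaddleAngles 0 K m s j h h := fun j => by
      refine ⟨⟨hm'.1, hm'.2⟩, ⟨hm'.1, hm'.2⟩, by simp, ?_⟩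
      rw [sum_saddle hN, alternating_self]
      linarith
    refine ⟨forwardInvariant_region hN hN2 hs hK hm, ?_, fun δ hδ α hα =>
      isStableEquilibrium_syncState hN hN2 hK hφ hP hδ hα, ?_⟩
    · rw [mem_region_iff hN2 hs hm, ← hh]
      have hc : ∀ i : Fin N, syncState N m 0 K i = 2 * π * m / N := fun i => by
        simp [syncState, alternating_self]
      refine ⟨fun i => ?_, ?_⟩
      · rw [hc]
        have e : (N : ℝ) * (s * (2 * π * m / N - h)) = π - 2 * (s * h) := by
          have : (N : ℝ) * (2 * π * m / N) = 2 * π * m := by field_simp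
          linear_combination s * this - s * hmul + π * hs1
        exact nonneg_of_mul_nonneg_right (e ▸ hsh.le) hNpos
      · rw [Finset.sum_congr rfl fun i _ => hc i]
        simp
        field_simp
    · rintro j T rfl
      refine ⟨?_, fun δ hδ => (core 0 K hK hP j h h (hab j) hcl hcl δ hδ).1, ?_, ?_,
        fun δ hδ => (core 0 K hK hP j h h (hab j) hcl hcl δ hδ).2⟩
      · rw [mem_region_iff hN2 hs hm, ← hh]
        refine ⟨fun i => ?_, (hab j).2.2.2⟩
        by_cases hi : i = j
        · rw [hi, saddle_same, alternating_self]
          linarith [show s * (s * π - h - h) = π - 2 * (s * h) by linear_combination π * hs1]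
        · rw [saddle_of_ne _ _ _ hi, alternating_self, sub_self, mul_zero]
      · obtain ⟨γ, hγ, hγr⟩ := exists_connection_saddle hN hN2 hs hK hm hη (hab j) hcl hcl
        refine ⟨γ, hγ, fun t => (mem_region_iff hN2 hs hm).2 ⟨fun i => ?_, sum_phaseDiff m _⟩⟩
        have := hγr t i
        rwa [alternating_self] at this
      · rintro x ⟨γ, hγ, rfl, hlim⟩ hreg hne
        -- Every point of the region other than a saddle lies in the basin. A point at another
        -- saddle is excluded since its trajectory is constant and could not have the backward limit
        -- T.
        refine ⟨γ, hγ, rfl, tendsto_of_mem_region hN hN2 hs hK hm hγ hreg fun k hk => hne ?_⟩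
        have heq : IsEquilibrium 0 K (γ 0) :=
          isEquilibrium_saddle hN hs hK (hab k).2.2.1 hk
        have hconst := trajectory_unique hγ (isTrajectory_const heq) rfl
        rw [hconst] at hlim
        exact tendsto_nhds_unique tendsto_const_nhds hlim
  · have hbd : η ≤ π / 2 - |h| - η := by
      have h1 : cos h ≤ π / 2 - |h| := by
        rw [← cos_abs, ← sin_pi_div_two_sub]
        exact sin_le (by linarith)
      linarith [hη.1, hη.2.1]
    have hη0 := hη.1
    obtain ⟨ε, hε, hang⟩ := exists_saddleAngles hN hN2 (m := m) (s := s) hη.1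
      (by rw [← hh]; linarith [neg_abs_le h]) (by rw [← hh]; linarith [le_abs_self h])
    -- The first bound gives saddle angles η-close to θ̂, the second the stability of the
    -- synchronous state.
    refine ⟨min ε (2 * cos (2 * π * m / N) ^ 2), lt_min hε hcos, fun P K hK hPK => ?_⟩
    have hP := hPK.trans_le (min_le_right _ _)
    refine ⟨fun δ hδ α hα => isStableEquilibrium_syncState hN hN2 hK hφ hP hδ hα, fun j => ?_⟩
    obtain ⟨hex, hcl'⟩ := hang P K hK (hPK.trans_le (min_le_left _ _)) j
    refine ⟨hex, ?_⟩
    rintro a b T hab rfl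
    obtain ⟨ha, hb⟩ := hcl' a b hab
    obtain ⟨γ, hγ, -⟩ := exists_connection_saddle hN hN2 hs hK hm hη hab ha hb
    exact ⟨fun δ hδ => (core P K hK hP j a b hab ha hb δ hδ).1, ⟨γ, hγ⟩,
      fun δ hδ => (core P K hK hP j a b hab ha hb δ hδ).2⟩
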